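/- **Setting.** Items with positive real weights $w_i$ arrive one at a time, and a reservoir of capacity $k\ge 1$ is maintained. Once it is full, it consists of a threshold $\tau\ge 0$, a set $L$ of large items ($w_i>\tau$, adjusted weight $\tilde w_i=w_i$) and a set $T$ of small items (adjusted weight $\tilde w_i=\tau$), with $|L|+|T|=k$. Initially $L=T=\emptyset$ and $\tau=0$. Both sets are stored in height-balanced (AVL) binary trees, $L$ sorted by weight and $T$ in arbitrary order; each node stores the number of items and the total weight of its subtree. Insertion, deletion, split, concatenation and search cost one step per recursive call. The smallest weight $w_\ell$ in $L$ is also stored ($w_\ell=\infty$ if $L=\emptyset$). A new item $j$ is processed as follows. *Filling.* If $|L|+|T|<k$, insert $j$ into $L$. *Fast path.* Otherwise let $\tau'=(w_j+|T|\tau)/|T|$. If $|T|=0$, $w_j\ge\tau'$ or $\tau'\ge w_\ell$, use the tree implementation below. Otherwise draw a uniformly random $r\in(0,1)$. If $\tau'-w_j\ge r\tau'$, skip item $j$ and set $\tau:=\tau'$; nothing else is done (this is the simple case). If not, use the tree implementation with this $r$ and with $j$ first in the order. *Tree implementation.* Order the $k+1$ items of $L\cup T\cup\{j\}$ as $\tilde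 w_{(1)},\dots,\tilde w_{(k+1)}$ by increasing adjusted weight (with $\tilde w_j=w_j$). In the case just mentioned, $j$ is instead placed first; in general $j$ comes first if $w_j\le\tau$, and is inserted into $L$ otherwise. Using binary search in the trees, find the largest $t$ with $\sum_{x\le t}\tilde w_{(x)}\ge (t-1)\tilde w_{(t)}$, set $\tau_{\rm new}=\sum_{x\le t}\tilde w_{(x)}/(t-1)$, and, for a uniformly random $r\in(0,1)$, find the smallest $d\le t$ with $d\,\tau_{\rm new}-\sum_{x\le d}\tilde w_{(x)}\ge r\,\tau_{\rm new}$. Drop the $d$-th item, move the remaining ones among the first $t$ items to $T$ (by splitting $L$ and concatenating), and set $\tau:=\tau_{\rm new}$. Time is counted on a real RAM: real arithmetic, comparisons, accessing or creating a tree node, and drawing a random number take constant time. The random numbers of different rounds are independent. **Theorem.** There is an absolute constant $C$ such that for all integers $k\ge1$ and $n\ge 1$ and all positive weights $w_1,\dots,w_n$, if the $n$ items arrive in a uniformly random order, independent of the random numbers of the algorithm, then the expected time (over the order and over the random numbers) of processing the whole stream is at most $$C\,\bigl(n+k(\log k)(\log n)\bigr).$$ -/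

import Mathlib

noncomputable section

namespace VarOpt

/-- A value together with the number of unit-cost steps spent on computing it (real RAM).
Every call of a recursive procedure and every call of one of the main procedures below is charged
one step; besides the charged calls, each of their bodies performs only a bounded number of
elementary operations: real and integer arithmetic, comparisons, reading or creating a tree node
and, in the main procedure, the generation of one random number. -/
structure Timed (α : Type) where
  val : α
  steps : ℕ

instance : Monad Timed where
  pure a := ⟨a, 0⟩
  bind x f := ⟨(f x.val).val, x.steps + (f x.val).steps⟩

/-- Spend one step. -/
def tick : Timed Unit := ⟨(), 1⟩

/-- A stream item, with its identity and its weight. -/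
structure Item where
  id : ℕ
  weight : ℝ

/-- Binary trees whose nodes cache the height, the number of items and the total weight of the
subtree that they root. -/
inductive Tree where
  | leaf : Tree
  | node (height size : ℕ) (total : ℝ) (left : Tree) (item : Item) (right : Tree) : Tree

namespace Tree

/-- The cached height (constant time). -/
def height : Tree → ℕ
  | leaf => 0
  | node h _ _ _ _ _ => h

/-- The cached number of items (constant time). -/
def size : Tree → ℕ
  | leaf => 0
  | node _ n _ _ _ _ => n

/-- The cached total weight (constant time). -/
def total : Tree → ℝ
  | leaf => 0
  | node _ _ s _ _ _ => s

/-- Create one node. -/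
def mk (l : Tree) (x : Item) (r : Tree) : Tree :=
  node (max l.height r.height + 1) (l.size + 1 + r.size) (l.total + x.weight + r.total) l x r

/-- Create a node and restore the AVL condition by a single or a double rotation where the heights
of the two subtrees differ by two. -/
def balance (l : Tree) (x : Item) (r : Tree) : Tree :=
  if r.height + 1 < l.height then
    match l with
    | leaf => mk l x r
    | node _ _ _ ll y lr =>
      if lr.height ≤ ll.height then mk ll y (mk lr x r)
      else
        match lr with
        | leaf => mk l x r
        | node _ _ _ a z b => mk (mk ll y a) z (mk b x r)
  else if l.height + 1 < r.height then
    match r with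
    | leaf => mk l x r
    | node _ _ _ rl y rr =>
      if rl.height ≤ rr.height then mk (mk l x rl) y rr
      else
        match rl with
        | leaf => mk l x r
        | node _ _ _ a z b => mk (mk l x a) z (mk b y rr)
  else mk l x r

/-- Attach `x` and `r` on the right of `l`: descend the right spine of `l` to a subtree that is at
most one higher than `r`. -/
def joinRight (l : Tree) (x : Item) (r : Tree) : Timed Tree := do
  tick
  match l with
  | leaf => pure (mk leaf x r)
  | node h n s ll y lr =>
    if h ≤ r.height + 1 then pure (mk (node h n s ll y lr) x r)
    else
      let lr' ← joinRight lr x r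
      pure (balance ll y lr')

/-- Attach `l` and `x` on the left of `r`: descend the left spine of `r` to a subtree that is at
most one higher than `l`. -/
def joinLeft (l : Tree) (x : Item) (r : Tree) : Timed Tree := do
  tick
  match r with
  | leaf => pure (mk l x leaf)
  | node h n s rl y rr =>
    if h ≤ l.height + 1 then pure (mk l x (node h n s rl y rr))
    else
      let rl' ← joinLeft l x rl
      pure (balance rl' y rr)

/-- The AVL tree of the items of `l`, then `x`, then the items of `r`. -/
def join (l : Tree) (x : Item) (r : Tree) : Timed Tree := do
  tick
  if r.height ≤ l.height then joinRight l x r else joinLeft l x r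

/-- The tree of the first `i` items and the tree of the others. -/
def splitAt (i : ℕ) (t : Tree) : Timed (Tree × Tree) := do
  tick
  match t with
  | leaf => pure (leaf, leaf)
  | node _ _ _ l x r =>
    if i ≤ l.size then
      let p ← splitAt i l
      let b ← join p.2 x r
      pure (p.1, b)
    else
      let p ← splitAt (i - (l.size + 1)) r
      let a ← join l x p.1
      pure (a, p.2)

/-- Remove the first item, if there is one. -/
def popFirst (t : Tree) : Timed (Option (Item × Tree)) := do
  tick
  match t with
  | leaf => pure none
  | node _ _ _ l x r =>
    let p ← popFirst l
    match p with
    | none => pure (some (x, r))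
    | some (y, l') =>
      let t' ← join l' x r
      pure (some (y, t'))

/-- The weight of the first item, if there is one. -/
def firstWeight (t : Tree) : Timed (Option ℝ) := do
  tick
  match t with
  | leaf => pure none
  | node _ _ _ l x _ =>
    let p ← firstWeight l
    pure (some (p.getD x.weight))

/-- Concatenation. -/
def concat (a b : Tree) : Timed Tree := do
  tick
  let p ← popFirst b
  match p with
  | none => pure a
  | some (x, b') => join a x b'

/-- Delete the item that has exactly `i` items before it. -/
def deleteAt (i : ℕ) (t : Tree) : Timed Tree := do
  tick
  let p ← splitAt i t
  let q ← popFirst p.2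
  match q with
  | none => pure p.1
  | some (_, b) => concat p.1 b

/-- Binary search along a path from the root. At a node whose item is, in the order of the whole
tree, the `c`-th one, with total weight `s` of the first `c` items and with own weight `v`, the
search goes on to the right if `goRight c s v` and to the left otherwise. The result is the number
and the total weight of all the items to the left of the place where the search ends. The arguments
`c₀` and `s₀` accumulate the number and weight of the items to the left of the current subtree. -/
def search (goRight : ℕ → ℝ → ℝ → Prop) [∀ c s v, Decidable (goRight c s v)]
    (t : Tree) (c₀ : ℕ) (s₀ : ℝ) : Timed (ℕ × ℝ) := do
  tick
  match t with
  | leaf => pure (c₀, s₀)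
  | node _ _ _ l x r =>
    let c := c₀ + l.size + 1
    let s := s₀ + l.total + x.weight
    if goRight c s x.weight then search goRight r c s else search goRight l c₀ s₀

/-- Insert an item into a tree that is sorted by increasing weight. -/
def insertSorted (x : Item) (t : Tree) : Timed Tree := do
  tick
  let p ← search (fun _ _ v => v < x.weight) t 0 0
  let q ← splitAt p.1 t
  join q.1 x q.2

end Tree

/-- The reservoir: the large items (`w > τ`, adjusted weight `w`) in a tree sorted by weight, the
small items (adjusted weight `τ`) in a tree in arbitrary order, the threshold `τ`, and the smallest
large weight (`none` if there is no large item). -/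
structure State where
  large : Tree
  small : Tree
  τ : ℝ
  minLarge : Option ℝ

/-- The empty reservoir. -/
def State.init : State := ⟨Tree.leaf, Tree.leaf, 0, none⟩

/-- The logarithmic-time processing of the new item `x` with a full reservoir, with random number
`u`. If `light`, then `x` is treated as the first item of the order, outside both trees; otherwise
it is inserted into the tree of large items. -/
def slowStep (s : State) (x : Item) (u : ℝ) (light : Bool) : Timed State := do
  tick
  let L ← if light then pure s.large else Tree.insertSorted x s.large
  -- number and total adjusted weight of `x`, if light
  let cx : ℕ := if light then 1 else 0
  let wx : ℝ := if light then x.weight else 0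
  -- number and total adjusted weight of everything outside the tree of large items
  let c₀ : ℕ := cx + s.small.size
  let s₀ : ℝ := wx + s.small.size * s.τ
  -- the largest `t` such that the `t` smallest adjusted weights sum to at least
  -- `t - 1` times the `t`-th one; `p.1` of the `t` items are in `L`
  let p ← Tree.search (fun c S v => (((c₀ + c : ℕ) : ℝ) - 1) * v ≤ s₀ + S) L 0 0
  let t : ℕ := c₀ + p.1
  -- the new threshold
  let τ : ℝ := (s₀ + p.2) / ((t : ℝ) - 1)
  -- the item to drop is the first one, `d`, such that `d τ` minus the total adjusted weight of the
  -- first `d` items is at least `u τ`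
  if light = true ∧ u * τ ≤ τ - x.weight then
    -- `x` itself is dropped
    let q ← Tree.splitAt p.1 L
    let T ← Tree.concat s.small q.1
    let m ← Tree.firstWeight q.2
    pure ⟨q.2, T, τ, m⟩
  else if u * τ ≤ c₀ * τ - s₀ then
    -- a small item is dropped
    let d ← Tree.search
      (fun c _ _ => ((cx + c : ℕ) : ℝ) * τ - (wx + c * s.τ) < u * τ) s.small 0 0
    let T₁ ← Tree.deleteAt d.1 s.small
    let q ← Tree.splitAt p.1 L
    let T₂ ← Tree.concat T₁ q.1
    let T ← if light then Tree.join T₂ x Tree.leaf else pure T₂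
    let m ← Tree.firstWeight q.2
    pure ⟨q.2, T, τ, m⟩
  else
    -- an item of `L` is dropped
    let d ← Tree.search
      (fun c S _ => c₀ + c ≤ t ∧ ((c₀ + c : ℕ) : ℝ) * τ - (s₀ + S) < u * τ) L 0 0
    let L₁ ← Tree.deleteAt d.1 L
    let q ← Tree.splitAt (p.1 - 1) L₁
    let T₂ ← Tree.concat s.small q.1
    let T ← if light then Tree.join T₂ x Tree.leaf else pure T₂
    let m ← Tree.firstWeight q.2
    pure ⟨q.2, T, τ, m⟩

/-- The processing of one item with capacity `k` and random number `u`, with the constant-time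
treatment of the simple case. -/
def step (k : ℕ) (s : State) (x : Item) (u : ℝ) : Timed State := do
  tick
  if s.large.size + s.small.size < k then
    -- the reservoir is not yet full: include the item
    let L ← Tree.insertSorted x s.large
    let m ← Tree.firstWeight L
    pure ⟨L, s.small, s.τ, m⟩
  else
    -- the tentative new threshold
    let τ : ℝ := (x.weight + s.small.size * s.τ) / s.small.size
    if s.small.size = 0 ∨ τ ≤ x.weight ∨ (∃ v, s.minLarge = some v ∧ v ≤ τ) then
      slowStep s x u (decide (x.weight ≤ s.τ))
    else if u * τ ≤ τ - x.weight then
      -- the simple case: the item is skipped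
      pure { s with τ := τ }
    else
      slowStep s x u true

/-- Process a stream of items, each with the random number that is available for it. -/
def run (k : ℕ) : State → List (Item × ℝ) → Timed State
  | s, [] => pure s
  | s, (x, u) :: rest => do
    let s' ← step k s x u
    run k s' rest

/-- The stream in which item number `σ i`, with weight `w (σ i)`, arrives in round `i`, together
with the random number `u i` of this round. -/
def stream {n : ℕ} (w : Fin n → ℝ) (σ : Equiv.Perm (Fin n)) (u : Fin n → ℝ) : List (Item × ℝ) :=
  List.ofFn fun i => (⟨(σ i : ℕ), w (σ i)⟩, u i)

/-- The number of steps spent on the stream `stream w σ u` with capacity `k`. -/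
def time (k : ℕ) {n : ℕ} (w : Fin n → ℝ) (σ : Equiv.Perm (Fin n)) (u : Fin n → ℝ) : ℕ :=
  (run k State.init (stream w σ u)).steps

/-- The law of `n` independent uniformly random numbers in `(0, 1)`. -/
def uniformNumbers (n : ℕ) : MeasureTheory.Measure (Fin n → ℝ) :=
  MeasureTheory.Measure.pi fun _ => MeasureTheory.volume.restrict (Set.Ioo (0 : ℝ) 1)

/-- The expected number of steps on the weights `w`, arriving in a uniformly random order that is
independent of the random numbers of the algorithm. -/
def expectedTime (k : ℕ) {n : ℕ} (w : Fin n → ℝ) : ℝ :=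
  (∑ σ : Equiv.Perm (Fin n), ∫ u, (time k w σ u : ℝ) ∂uniformNumbers n) / (n.factorial : ℝ)

end VarOpt

end

/-!
After each round the state represents the set `A` of weights seen so far: its threshold is
`threshold k A`, and its large items are exactly the weights of `A` above it. Hence whether a new
item is kept depends only on `A`, on the item and on the current random number. A round that is not
the simple case traverses a bounded number of trees of logarithmic height, and it either keeps the
new item or moves a large item to the small ones for good; the second kind is paid for by the
insertions of the first kind. So the number of expensive rounds is at most twice the number of kept
items. The inclusion probabilities of the items seen so far sum to at most `k`, and in a random
order each of them is equally likely to be the last one, so that item `i` is kept with probability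
at most `min 1 (k / i)`. Summing over `i` gives the logarithm.
-/

namespace VarOpt

/-! ### Step counts and AVL trees -/

namespace Timed

variable {α β : Type}

@[simp]
theorem val_pure (a : α) : (pure a : Timed α).val = a := rfl

@[simp]
theorem steps_pure (a : α) : (pure a : Timed α).steps = 0 := rfl

@[simp]
theorem val_bind (x : Timed α) (f : α → Timed β) : (x >>= f).val = (f x.val).val := rfl

@[simp]
theorem steps_bind (x : Timed α) (f : α → Timed β) :
    (x >>= f).steps = x.steps + (f x.val).steps := rfl

@[simp]
theorem val_map (f : α → β) (x : Timed α) : (f <$> x).val = f x.val := rfl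

@[simp]
theorem steps_map (f : α → β) (x : Timed α) : (f <$> x).steps = x.steps := rfl

@[simp]
theorem steps_tick : tick.steps = 1 := rfl

@[ext]
theorem ext {x y : Timed α} (hval : x.val = y.val) (hsteps : x.steps = y.steps) : x = y := by
  cases x; cases y; simp_all

instance : LawfulMonad Timed :=
  LawfulMonad.mk' Timed
    (id_map := fun _ => by ext <;> simp [Functor.map])
    (pure_bind := fun _ _ => by ext <;> simp)
    (bind_assoc := fun _ _ _ => by ext <;> simp [Nat.add_assoc])

end Timed

section SortedList

variable {α : Type*} [Preorder α] {l : List α} {a : α}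

theorem exists_mem_head?_le (hl : l.SortedLE) (ha : a ∈ l) : ∃ b ∈ l.head?, b ≤ a := by
  cases l with
  | nil => simp at ha
  | cons b l =>
    refine ⟨b, rfl, ?_⟩
    rcases List.mem_cons.1 ha with rfl | ha
    · exact le_rfl
    · exact (List.pairwise_cons.1 hl.pairwise).1 a ha

theorem exists_mem_getLast?_ge (hl : l.SortedLE) (ha : a ∈ l) : ∃ b ∈ l.getLast?, a ≤ b := by
  rcases List.eq_nil_or_concat' l with rfl | ⟨l, b, rfl⟩
  · simp at ha
  · refine ⟨b, by simp, ?_⟩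
    rcases List.mem_append.1 ha with ha | ha
    · exact (List.pairwise_append.1 hl.pairwise).2.2 a ha b (List.mem_singleton_self b)
    · exact (List.mem_singleton.1 ha).le

theorem sortedLE_append {l₁ l₂ : List α} :
    (l₁ ++ l₂).SortedLE ↔ l₁.SortedLE ∧ l₂.SortedLE ∧ ∀ a ∈ l₁, ∀ b ∈ l₂, a ≤ b := by
  simp only [List.sortedLE_iff_pairwise, List.pairwise_append]

end SortedList

namespace Tree

/-- The weights of the items of a tree, from left to right. -/
def weights : Tree → List ℝ
  | leaf => []
  | node _ _ _ l x r => weights l ++ x.weight :: weights r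

/-- The AVL invariant: at every node the cached height, size and total weight are correct and the
heights of the two subtrees differ by at most one. -/
def IsAVL : Tree → Prop
  | leaf => True
  | node h n s l x r => IsAVL l ∧ IsAVL r ∧ h = max l.height r.height + 1 ∧
      n = l.size + 1 + r.size ∧ s = l.total + x.weight + r.total ∧
      l.height ≤ r.height + 1 ∧ r.height ≤ l.height + 1

section Basic

variable {h n : ℕ} {s : ℝ} {l r t : Tree} {x : Item}

@[simp]
theorem height_leaf : height leaf = 0 := rfl

@[simp]
theorem height_node : height (node h n s l x r) = h := rfl

@[simp]
theorem height_mk : height (mk l x r) = max l.height r.height + 1 := rfl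

@[simp]
theorem size_node : size (node h n s l x r) = n := rfl

@[simp]
theorem weights_leaf : weights leaf = [] := rfl

@[simp]
theorem weights_node : weights (node h n s l x r) = weights l ++ x.weight :: weights r := rfl

@[simp]
theorem weights_mk : weights (mk l x r) = weights l ++ x.weight :: weights r := rfl

@[simp]
theorem isAVL_leaf : IsAVL leaf := trivial

theorem isAVL_mk :
    IsAVL (mk l x r) ↔ IsAVL l ∧ IsAVL r ∧ l.height ≤ r.height + 1 ∧ r.height ≤ l.height + 1 := by
  simp [mk, IsAVL]

theorem IsAVL.size_eq (ht : IsAVL t) : t.size = t.weights.length := by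
  induction t with
  | leaf => rfl
  | node h n s l x r ihl ihr =>
    obtain ⟨hl, hr, -, rfl, -⟩ := ht
    simp only [size_node, weights_node, List.length_append, List.length_cons, ← ihl hl, ← ihr hr]
    ring

theorem IsAVL.total_eq (ht : IsAVL t) : t.total = t.weights.sum := by
  induction t with
  | leaf => rfl
  | node h n s l x r ihl ihr =>
    obtain ⟨hl, hr, -, -, rfl, -⟩ := ht
    simp only [total, weights_node, List.sum_append, List.sum_cons, ← ihl hl, ← ihr hr]
    ring

theorem IsAVL.eq_leaf_of_height_eq_zero (ht : IsAVL t) (h : t.height = 0) : t = leaf := by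
  cases t with
  | leaf => rfl
  | node => exact absurd (ht.2.2.1.symm.trans h) (Nat.succ_ne_zero _)

theorem IsAVL.two_pow_height_le (ht : IsAVL t) : 2 ^ (t.height / 2) ≤ t.size + 1 := by
  induction t with
  | leaf => simp
  | node h n s l x r ihl ihr =>
    obtain ⟨hl, hr, hh, rfl, -, hlr, hrl⟩ := ht
    simp only [height_node, size_node]
    rcases Nat.lt_or_ge h 2 with h_small | h_large
    · rw [Nat.div_eq_of_lt h_small]
      lia
    · have pow_le_left : 2 ^ ((h - 2) / 2) ≤ l.size + 1 :=
        (Nat.pow_le_pow_right two_pos (by lia)).trans (ihl hl)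
      have pow_le_right : 2 ^ ((h - 2) / 2) ≤ r.size + 1 :=
        (Nat.pow_le_pow_right two_pos (by lia)).trans (ihr hr)
      rw [show h / 2 = (h - 2) / 2 + 1 by lia, pow_succ]
      lia

/-- A logarithmic bound on the height of an AVL tree with at most `N` items. -/
def maxHeight (N : ℕ) : ℕ := 2 * Nat.log 2 (N + 1) + 1

theorem IsAVL.height_le_maxHeight (ht : IsAVL t) {N : ℕ} (hN : t.size ≤ N) :
    t.height ≤ maxHeight N := by
  have : t.height / 2 ≤ Nat.log 2 (N + 1) :=
    Nat.le_log_of_pow_le one_lt_two (ht.two_pow_height_le.trans (Nat.add_le_add_right hN 1))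
  unfold maxHeight
  lia

end Basic

section Balance

variable {l r : Tree} {x : Item}

@[simp]
theorem weights_balance (l : Tree) (x : Item) (r : Tree) :
    weights (balance l x r) = weights l ++ x.weight :: weights r := by
  unfold balance
  repeat' first | split | rfl
  all_goals simp

theorem balance_eq_mk (hlr : l.height ≤ r.height + 1) (hrl : r.height ≤ l.height + 1) :
    balance l x r = mk l x r := by
  unfold balance
  rw [if_neg (by lia), if_neg (by lia)]

theorem isAVL_balance_and_height_balance (hl : IsAVL l) (hr : IsAVL r)
    (hlr : l.height ≤ r.height + 2) (hrl : r.height ≤ l.height + 2) :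
    IsAVL (balance l x r) ∧
      (balance l x r).height ∈ Set.Icc (max l.height r.height) (max l.height r.height + 1) := by
  rw [Set.mem_Icc]
  unfold balance
  repeat' split
  all_goals simp_all only [isAVL_mk, height_mk, height_node, height_leaf, IsAVL]
  all_goals grind

end Balance

section Join

variable {l r : Tree} {x : Item}

@[simp]
theorem weights_joinRight (l : Tree) (x : Item) (r : Tree) :
    weights (joinRight l x r).val = weights l ++ x.weight :: weights r := by
  induction l with
  | leaf => simp [joinRight]
  | node h n s ll y lr _ ih =>
    rw [joinRight]
    split_ifs <;> simp [ih]

@[simp]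
theorem weights_joinLeft (l : Tree) (x : Item) (r : Tree) :
    weights (joinLeft l x r).val = weights l ++ x.weight :: weights r := by
  induction r with
  | leaf => simp [joinLeft]
  | node h n s rl y rr ih _ =>
    rw [joinLeft]
    split_ifs <;> simp [ih]

theorem isAVL_joinRight_and_height_joinRight (hl : IsAVL l) (hr : IsAVL r)
    (h : r.height ≤ l.height) :
    IsAVL (joinRight l x r).val ∧
      (joinRight l x r).val.height ∈ Set.Icc l.height (l.height + 1) := by
  induction l with
  | leaf =>
    obtain rfl := hr.eq_leaf_of_height_eq_zero (Nat.le_zero.1 h)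
    simp [joinRight, isAVL_mk]
  | node hh n s ll y lr _ ih =>
    have ⟨hll, hlr, hh_eq, _, _, hdiff, hdiff'⟩ := hl
    rw [joinRight]
    simp only [height_node, Set.mem_Icc, Timed.val_bind] at h ⊢
    split_ifs with h_attach
    · simp only [Timed.val_pure, isAVL_mk, height_mk, height_node]
      exact ⟨⟨hl, hr, h_attach, by lia⟩, by lia⟩
    · obtain ⟨ih_avl, ih_height⟩ := ih hlr (by lia)
      rw [Set.mem_Icc] at ih_height
      simp only [Timed.val_bind, Timed.val_pure]
      have h_balance := isAVL_balance_and_height_balance (x := y) hll ih_avl (by lia) (by lia)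
      rw [Set.mem_Icc] at h_balance
      refine ⟨h_balance.1, ?_⟩
      rcases Nat.lt_or_ge (ll.height + 1) (joinRight lr x r).val.height with h_rotate | h_flat
      · lia
      · rw [balance_eq_mk (by lia) h_flat, height_mk]
        lia

theorem isAVL_joinLeft_and_height_joinLeft (hl : IsAVL l) (hr : IsAVL r)
    (h : l.height ≤ r.height) :
    IsAVL (joinLeft l x r).val ∧
      (joinLeft l x r).val.height ∈ Set.Icc r.height (r.height + 1) := by
  induction r with
  | leaf =>
    obtain rfl := hl.eq_leaf_of_height_eq_zero (Nat.le_zero.1 h)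
    simp [joinLeft, isAVL_mk]
  | node hh n s rl y rr ih _ =>
    have ⟨hrl, hrr, hh_eq, _, _, hdiff, hdiff'⟩ := hr
    rw [joinLeft]
    simp only [height_node, Set.mem_Icc, Timed.val_bind] at h ⊢
    split_ifs with h_attach
    · simp only [Timed.val_pure, isAVL_mk, height_mk, height_node]
      exact ⟨⟨hl, hr, by lia, h_attach⟩, by lia⟩
    · obtain ⟨ih_avl, ih_height⟩ := ih hrl (by lia)
      rw [Set.mem_Icc] at ih_height
      simp only [Timed.val_bind, Timed.val_pure]
      have h_balance := isAVL_balance_and_height_balance (x := y) ih_avl hrr (by lia) (by lia)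
      rw [Set.mem_Icc] at h_balance
      refine ⟨h_balance.1, ?_⟩
      rcases Nat.lt_or_ge (rr.height + 1) (joinLeft l x rl).val.height with h_rotate | h_flat
      · lia
      · rw [balance_eq_mk h_flat (by lia), height_mk]
        lia

theorem steps_joinRight_le (hl : IsAVL l) :
    (joinRight l x r).steps ≤ l.height - r.height + 1 := by
  induction l with
  | leaf => simp [joinRight]
  | node hh n s ll y lr _ ih =>
    obtain ⟨_, hlr, hh_eq, _⟩ := hl
    specialize ih hlr
    rw [joinRight]
    split_ifs <;>
      (simp only [Timed.steps_bind, Timed.steps_tick, Timed.steps_pure, height_node]; lia)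

theorem steps_joinLeft_le (hr : IsAVL r) :
    (joinLeft l x r).steps ≤ r.height - l.height + 1 := by
  induction r with
  | leaf => simp [joinLeft]
  | node hh n s rl y rr ih _ =>
    obtain ⟨hrl, _, hh_eq, _⟩ := hr
    specialize ih hrl
    rw [joinLeft]
    split_ifs <;>
      (simp only [Timed.steps_bind, Timed.steps_tick, Timed.steps_pure, height_node]; lia)

@[simp]
theorem weights_join (l : Tree) (x : Item) (r : Tree) :
    weights (join l x r).val = weights l ++ x.weight :: weights r := by
  rw [join]
  split_ifs <;> simp

theorem isAVL_join_and_height_join (hl : IsAVL l) (hr : IsAVL r) :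
    IsAVL (join l x r).val ∧
      (join l x r).val.height ∈ Set.Icc (max l.height r.height) (max l.height r.height + 1) := by
  rw [join]
  split_ifs with h
  · rw [max_eq_left h]
    exact isAVL_joinRight_and_height_joinRight hl hr h
  · rw [max_eq_right (le_of_not_ge h)]
    exact isAVL_joinLeft_and_height_joinLeft hl hr (le_of_not_ge h)

theorem isAVL_join (hl : IsAVL l) (hr : IsAVL r) : IsAVL (join l x r).val :=
  (isAVL_join_and_height_join hl hr).1

theorem height_join_le (hl : IsAVL l) (hr : IsAVL r) :
    (join l x r).val.height ≤ max l.height r.height + 1 :=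
  (isAVL_join_and_height_join hl hr).2.2

theorem le_height_join (hl : IsAVL l) (hr : IsAVL r) :
    max l.height r.height ≤ (join l x r).val.height :=
  (isAVL_join_and_height_join hl hr).2.1

theorem steps_join_add_min_le (hl : IsAVL l) (hr : IsAVL r) :
    (join l x r).steps + min l.height r.height ≤ max l.height r.height + 2 := by
  have := steps_joinRight_le (r := r) (x := x) hl
  have := steps_joinLeft_le (l := l) (x := x) hr
  rw [join]
  split_ifs <;> simp only [Timed.steps_bind, Timed.steps_tick] <;> lia

end Join

section Split

variable {a b t : Tree} {x : Item}

theorem isAVL_splitAt_and_height_splitAt_le (i : ℕ) (ht : IsAVL t) :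
    (IsAVL (splitAt i t).val.1 ∧ IsAVL (splitAt i t).val.2) ∧
      (splitAt i t).val.1.height ≤ t.height ∧ (splitAt i t).val.2.height ≤ t.height := by
  induction t generalizing i with
  | leaf => simp [splitAt]
  | node h n s l x r ihl ihr =>
    obtain ⟨hl, hr, hh, -⟩ := ht
    rw [splitAt]
    split_ifs with hi
    · obtain ⟨⟨avl₁, avl₂⟩, height₁, height₂⟩ := ihl i hl
      have := height_join_le (x := x) avl₂ hr
      simp only [Timed.val_bind, Timed.val_pure, height_node]
      exact ⟨⟨avl₁, isAVL_join avl₂ hr⟩, by lia, by lia⟩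
    · obtain ⟨⟨avl₁, avl₂⟩, height₁, height₂⟩ := ihr (i - (l.size + 1)) hr
      have := height_join_le (x := x) hl avl₁
      simp only [Timed.val_bind, Timed.val_pure, height_node]
      exact ⟨⟨isAVL_join hl avl₁, avl₂⟩, by lia, by lia⟩

theorem weights_splitAt (i : ℕ) (ht : IsAVL t) :
    weights (splitAt i t).val.1 = t.weights.take i ∧
      weights (splitAt i t).val.2 = t.weights.drop i := by
  induction t generalizing i with
  | leaf => simp [splitAt]
  | node h n s l x r ihl ihr =>
    obtain ⟨hl, hr, -⟩ := ht
    rw [splitAt, hl.size_eq]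
    split_ifs with hi
    · simp [ihl i hl, List.take_append_of_le_length hi, List.drop_append_of_le_length hi]
    · obtain ⟨j, rfl⟩ : ∃ j, i = l.weights.length + (j + 1) := ⟨i - l.weights.length - 1, by lia⟩
      simp [ihr _ hr, show l.weights.length + (j + 1) - (l.weights.length + 1) = j by lia,
        List.take_length_add_append, List.drop_length_add_append]

-- The height of the two parts pays for the joins along the path: their costs telescope.
theorem steps_splitAt_le_add (i : ℕ) (ht : IsAVL t) :
    (splitAt i t).steps ≤
      (splitAt i t).val.1.height + (splitAt i t).val.2.height + 4 * t.height + 1 := by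
  induction t generalizing i with
  | leaf => simp [splitAt]
  | node h n s l x r ihl ihr =>
    obtain ⟨hl, hr, hh, -, -, hlr, hrl⟩ := ht
    rw [splitAt]
    simp only [Timed.val_bind, Timed.steps_bind, Timed.steps_tick, height_node]
    split_ifs with hi
    · obtain ⟨⟨-, avl₂⟩, -, height₂⟩ := isAVL_splitAt_and_height_splitAt_le i hl
      have := ihl i hl
      have := steps_join_add_min_le (x := x) avl₂ hr
      have := le_height_join (x := x) avl₂ hr
      simp only [Timed.val_bind, Timed.steps_bind, Timed.val_pure, Timed.steps_pure]
      lia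
    · obtain ⟨⟨avl₁, -⟩, height₁, -⟩ := isAVL_splitAt_and_height_splitAt_le (i - (l.size + 1)) hr
      have := ihr (i - (l.size + 1)) hr
      have := steps_join_add_min_le (x := x) hl avl₁
      have := le_height_join (x := x) hl avl₁
      simp only [Timed.val_bind, Timed.steps_bind, Timed.val_pure, Timed.steps_pure]
      lia

theorem steps_splitAt_le (i : ℕ) (ht : IsAVL t) : (splitAt i t).steps ≤ 6 * t.height + 1 := by
  have := steps_splitAt_le_add i ht
  have := isAVL_splitAt_and_height_splitAt_le i ht
  lia

@[simp]
theorem val_popFirst_leaf : (popFirst leaf).val = none := rfl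

theorem popFirst_eq_none (ht : (popFirst t).val = none) : t = leaf := by
  cases t with
  | leaf => rfl
  | node h n s l y r =>
    rw [popFirst] at ht
    cases hl : (popFirst l).val <;> simp [hl] at ht

theorem weights_eq_of_popFirst_eq_some {t' : Tree} (ht : (popFirst t).val = some (x, t')) :
    t.weights = x.weight :: t'.weights := by
  induction t generalizing x t' with
  | leaf => simp [popFirst] at ht
  | node h n s l y r ih _ =>
    rw [popFirst] at ht
    cases hl : (popFirst l).val with
    | none => simp_all [popFirst_eq_none hl]
    | some p =>
      simp only [Timed.val_bind, hl, Timed.val_pure, Option.some.injEq, Prod.mk.injEq] at ht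
      simp [← ht.1, ← ht.2, ih hl]

theorem isAVL_and_height_le_of_popFirst_eq_some {t' : Tree} (ht : IsAVL t)
    (h : (popFirst t).val = some (x, t')) : IsAVL t' ∧ t'.height ≤ t.height := by
  induction t generalizing x t' with
  | leaf => simp [popFirst] at h
  | node hh n s l y r ih _ =>
    obtain ⟨hl, hr, hh_eq, -⟩ := ht
    rw [popFirst] at h
    cases h_pop : (popFirst l).val with
    | none =>
      simp only [Timed.val_bind, h_pop, Timed.val_pure, Option.some.injEq, Prod.mk.injEq] at h
      exact ⟨h.2 ▸ hr, by rw [← h.2, height_node]; lia⟩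
    | some p =>
      simp only [Timed.val_bind, h_pop, Timed.val_pure, Option.some.injEq, Prod.mk.injEq] at h
      obtain ⟨avl, height_le⟩ := ih hl h_pop
      have := height_join_le (x := y) avl hr
      exact ⟨h.2 ▸ isAVL_join avl hr, by rw [← h.2, height_node]; lia⟩

theorem steps_popFirst_le_add (ht : IsAVL t) :
    (popFirst t).steps ≤
      ((popFirst t).val.elim leaf Prod.snd).height + 4 * t.height + 2 := by
  induction t with
  | leaf => simp [popFirst]
  | node h n s l y r ih _ =>
    obtain ⟨hl, hr, hh, -, -, hlr, hrl⟩ := ht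
    have ih := ih hl
    rw [popFirst]
    cases h_pop : (popFirst l).val with
    | none =>
      obtain rfl := popFirst_eq_none h_pop
      simp [popFirst]
    | some p =>
      obtain ⟨avl, height_le⟩ := isAVL_and_height_le_of_popFirst_eq_some hl h_pop
      have := steps_join_add_min_le (x := y) avl hr
      have := le_height_join (x := y) avl hr
      rw [h_pop, Option.elim_some] at ih
      simp only [Timed.val_bind, Timed.steps_bind, Timed.steps_tick, h_pop, Timed.val_pure,
        Timed.steps_pure, height_node, Option.elim_some]
      lia

theorem steps_popFirst_le (ht : IsAVL t) : (popFirst t).steps ≤ 5 * t.height + 2 := by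
  have h_steps := steps_popFirst_le_add ht
  cases h : (popFirst t).val with
  | none =>
    rw [h, Option.elim_none, height_leaf] at h_steps
    lia
  | some p =>
    have := isAVL_and_height_le_of_popFirst_eq_some ht h
    rw [h, Option.elim_some] at h_steps
    lia

theorem firstWeight_eq_head? (t : Tree) : (firstWeight t).val = t.weights.head? := by
  induction t with
  | leaf => simp [firstWeight]
  | node h n s l x r ih _ =>
    rw [firstWeight]
    cases hl : l.weights <;> simp [ih, hl]

theorem steps_firstWeight_le (ht : IsAVL t) : (firstWeight t).steps ≤ t.height + 1 := by
  induction t with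
  | leaf => simp [firstWeight]
  | node h n s l x r ih _ =>
    obtain ⟨hl, -, hh, -⟩ := ht
    have := ih hl
    simp only [firstWeight, Timed.steps_bind, Timed.steps_tick, Timed.steps_pure, height_node]
    lia

@[simp]
theorem weights_concat (a b : Tree) : weights (concat a b).val = a.weights ++ b.weights := by
  rw [concat]
  cases h : (popFirst b).val with
  | none => simp [popFirst_eq_none h]
  | some p => simp [h, weights_eq_of_popFirst_eq_some h]

theorem isAVL_concat_and_height_concat_le (ha : IsAVL a) (hb : IsAVL b) :
    IsAVL (concat a b).val ∧ (concat a b).val.height ≤ max a.height b.height + 1 := by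
  rw [concat]
  cases h : (popFirst b).val with
  | none =>
    simp only [Timed.val_bind, h, Timed.val_pure, ha, true_and]
    lia
  | some p =>
    obtain ⟨avl, height_le⟩ := isAVL_and_height_le_of_popFirst_eq_some hb h
    have := height_join_le (x := p.1) ha avl
    simp only [Timed.val_bind, h, isAVL_join ha avl, true_and]
    lia

theorem steps_concat_le (ha : IsAVL a) (hb : IsAVL b) :
    (concat a b).steps ≤ a.height + 6 * b.height + 5 := by
  have := steps_popFirst_le hb
  rw [concat]
  cases h : (popFirst b).val with
  | none =>
    simp only [Timed.steps_bind, Timed.steps_tick, h, Timed.steps_pure]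
    lia
  | some p =>
    obtain ⟨avl, height_le⟩ := isAVL_and_height_le_of_popFirst_eq_some hb h
    have := steps_join_add_min_le (x := p.1) ha avl
    simp only [Timed.steps_bind, Timed.steps_tick, h]
    lia

theorem weights_deleteAt (i : ℕ) (ht : IsAVL t) :
    weights (deleteAt i t).val = t.weights.take i ++ t.weights.drop (i + 1) := by
  obtain ⟨weights₁, weights₂⟩ := weights_splitAt i ht
  rw [deleteAt, ← List.tail_drop, ← weights₁, ← weights₂]
  cases h : (popFirst (splitAt i t).val.2).val with
  | none => simp [popFirst_eq_none h]
  | some p => simp [h, weights_eq_of_popFirst_eq_some h]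

theorem isAVL_deleteAt_and_height_deleteAt_le (i : ℕ) (ht : IsAVL t) :
    IsAVL (deleteAt i t).val ∧ (deleteAt i t).val.height ≤ t.height + 1 := by
  obtain ⟨⟨avl₁, avl₂⟩, height₁, height₂⟩ := isAVL_splitAt_and_height_splitAt_le i ht
  rw [deleteAt]
  cases h : (popFirst (splitAt i t).val.2).val with
  | none =>
    simp only [Timed.val_bind, h, Timed.val_pure, avl₁, true_and]
    lia
  | some p =>
    obtain ⟨avl, height_le⟩ := isAVL_and_height_le_of_popFirst_eq_some avl₂ h
    obtain ⟨avl_concat, height_concat⟩ := isAVL_concat_and_height_concat_le avl₁ avl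
    simp only [Timed.val_bind, h, avl_concat, true_and]
    lia

theorem steps_deleteAt_le (i : ℕ) (ht : IsAVL t) :
    (deleteAt i t).steps ≤ 18 * t.height + 9 := by
  obtain ⟨⟨avl₁, avl₂⟩, height₁, height₂⟩ := isAVL_splitAt_and_height_splitAt_le i ht
  have := steps_splitAt_le i ht
  have := steps_popFirst_le avl₂
  rw [deleteAt]
  cases h : (popFirst (splitAt i t).val.2).val with
  | none =>
    simp only [Timed.steps_bind, Timed.steps_tick, h, Timed.steps_pure]
    lia
  | some p =>
    obtain ⟨avl, height_le⟩ := isAVL_and_height_le_of_popFirst_eq_some avl₂ h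
    have := steps_concat_le avl₁ avl
    simp only [Timed.steps_bind, Timed.steps_tick, h]
    lia

end Split

section Search

variable {goRight : ℕ → ℝ → ℝ → Prop} {t : Tree} {x : Item} {c : ℕ} {s : ℝ}

/-- A possible end of the binary search `search goRight` with accumulators `c` and `s` in a list of
weights: the list is split into `a` and `b` such that `goRight` holds at the last element of `a` and
fails at the first element of `b`. -/
structure IsStop (goRight : ℕ → ℝ → ℝ → Prop) (c : ℕ) (s : ℝ) (a b : List ℝ) : Prop where
  last : ∀ v ∈ a.getLast?, goRight (c + a.length) (s + a.sum) v
  first : ∀ v ∈ b.head?, ¬ goRight (c + a.length + 1) (s + a.sum + v) v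

theorem exists_isStop_search (goRight : ℕ → ℝ → ℝ → Prop) [∀ c s v, Decidable (goRight c s v)]
    (ht : IsAVL t) (c : ℕ) (s : ℝ) :
    ∃ a b, t.weights = a ++ b ∧ (search goRight t c s).val = (c + a.length, s + a.sum) ∧
      IsStop goRight c s a b := by
  induction t generalizing c s with
  | leaf => exact ⟨[], [], by simp, by simp [search], by simp, by simp⟩
  | node h n tot l x r ihl ihr =>
    obtain ⟨hl, hr, -⟩ := ht
    simp only [search, Timed.val_bind, hl.size_eq, hl.total_eq]
    split_ifs with h_right
    · obtain ⟨a, b, h_split, h_val, hend⟩ := ihr hr (c + l.weights.length + 1)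
        (s + l.weights.sum + x.weight)
      have h_count :
          c + (l.weights ++ x.weight :: a).length = c + l.weights.length + 1 + a.length := by
        simp only [List.length_append, List.length_cons]; ring
      have h_sum :
          s + (l.weights ++ x.weight :: a).sum = s + l.weights.sum + x.weight + a.sum := by
        simp only [List.sum_append, List.sum_cons]; ring
      refine ⟨l.weights ++ x.weight :: a, b, by simp [h_split], by rw [h_val, h_count, h_sum],
        ?_, ?_⟩
      · intro v hv
        rw [h_count, h_sum]
        rcases List.eq_nil_or_concat' a with rfl | ⟨a', v', rfl⟩
        · simp only [List.getLast?_append, List.getLast?_singleton, Option.some_or,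
            Option.mem_some_iff] at hv
          simpa [← hv] using h_right
        · exact hend.last v (by simpa [List.getLast?_cons] using hv)
      · rw [h_count, h_sum]
        exact hend.first
    · obtain ⟨a, b, h_split, h_val, hend⟩ := ihl hl c s
      refine ⟨a, b ++ x.weight :: r.weights, by simp [h_split], h_val, hend.last, ?_⟩
      intro v hv
      cases b with
      | nil => simp_all
      | cons v' b' => exact hend.first v (by simpa using hv)

theorem steps_search_le [∀ c s v, Decidable (goRight c s v)] (ht : IsAVL t) :
    (search goRight t c s).steps ≤ t.height + 1 := by
  induction t generalizing c s with
  | leaf => simp [search]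
  | node h n tot l y r ihl ihr =>
    obtain ⟨hl, hr, hh, -⟩ := ht
    simp only [search, Timed.steps_bind, Timed.steps_tick, height_node]
    split_ifs
    · have := ihr (c := c + l.size + 1) (s := s + l.total + y.weight) hr
      lia
    · have := ihl (c := c) (s := s) hl
      lia

end Search

section Insert

variable {t : Tree} {x : Item}

theorem exists_weights_insertSorted (ht : IsAVL t) (hs : t.weights.SortedLE) :
    ∃ a b, t.weights = a ++ b ∧ (insertSorted x t).val.weights = a ++ x.weight :: b ∧
      (∀ y ∈ a, y ≤ x.weight) ∧ ∀ y ∈ b, x.weight ≤ y := by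
  obtain ⟨a, b, h_split, h_val, hend⟩ :=
    exists_isStop_search (fun _ _ v => v < x.weight) ht 0 0
  obtain ⟨weights₁, weights₂⟩ := weights_splitAt a.length ht
  rw [h_split, List.take_left] at weights₁
  rw [h_split, List.drop_left] at weights₂
  obtain ⟨ha, hb, -⟩ := sortedLE_append.1 (h_split ▸ hs)
  refine ⟨a, b, h_split, ?_, ?_, ?_⟩
  · simp [insertSorted, h_val, weights₁, weights₂]
  · intro y hy
    obtain ⟨z, hz, hyz⟩ := exists_mem_getLast?_ge ha hy
    exact hyz.trans (hend.last z hz).le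
  · intro y hy
    obtain ⟨z, hz, hzy⟩ := exists_mem_head?_le hb hy
    exact (not_lt.1 (hend.first z hz)).trans hzy

theorem sortedLE_weights_insertSorted (ht : IsAVL t) (hs : t.weights.SortedLE) :
    (insertSorted x t).val.weights.SortedLE := by
  obtain ⟨a, b, h_split, h_weights, ha, hb⟩ := exists_weights_insertSorted (x := x) ht hs
  have ⟨ha_sorted, hb_sorted, hab⟩ := sortedLE_append.1 (h_split ▸ hs)
  rw [h_weights]
  refine sortedLE_append.2
    ⟨ha_sorted, (List.pairwise_cons.2 ⟨hb, hb_sorted.pairwise⟩).sortedLE, ?_⟩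
  simp only [List.mem_cons]
  rintro y hy z (rfl | hz)
  · exact ha y hy
  · exact hab y hy z hz

theorem coe_weights_insertSorted (ht : IsAVL t) (hs : t.weights.SortedLE) :
    ((insertSorted x t).val.weights : Multiset ℝ) = x.weight ::ₘ (t.weights : Multiset ℝ) := by
  obtain ⟨a, b, h_split, h_weights, -⟩ := exists_weights_insertSorted (x := x) ht hs
  rw [h_weights, h_split, Multiset.cons_coe, Multiset.coe_eq_coe]
  exact List.perm_middle

theorem isAVL_insertSorted_and_height_insertSorted_le (ht : IsAVL t) :
    IsAVL (insertSorted x t).val ∧ (insertSorted x t).val.height ≤ t.height + 1 := by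
  simp only [insertSorted, Timed.val_bind]
  obtain ⟨⟨avl₁, avl₂⟩, height₁, height₂⟩ := isAVL_splitAt_and_height_splitAt_le
    (search (fun _ _ v => v < x.weight) t 0 0).val.1 ht
  have := height_join_le (x := x) avl₁ avl₂
  exact ⟨isAVL_join avl₁ avl₂, by lia⟩

theorem steps_insertSorted_le (ht : IsAVL t) :
    (insertSorted x t).steps ≤ 8 * t.height + 5 := by
  have := steps_search_le (goRight := fun _ _ v => v < x.weight) (c := 0) (s := 0) ht
  simp only [insertSorted, Timed.steps_bind, Timed.steps_tick]
  set i := (search (fun _ _ v => v < x.weight) t 0 0).val.1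
  obtain ⟨⟨avl₁, avl₂⟩, height₁, height₂⟩ := isAVL_splitAt_and_height_splitAt_le i ht
  have := steps_splitAt_le i ht
  have := steps_join_add_min_le (x := x) avl₁ avl₂
  lia

end Insert

end Tree

/-! ### The threshold -/

section Threshold

variable {k : ℕ} {A : Multiset ℝ} {τ τ' w : ℝ}

/-- The expected number of items in a sample that contains an item of weight `a` with probability
`min 1 (a / τ)`. It is meant for `0 < τ` only. -/
noncomputable def sampleSize (A : Multiset ℝ) (τ : ℝ) : ℝ := (A.map fun a => min 1 (a / τ)).sum

theorem sampleSize_cons : sampleSize (w ::ₘ A) τ = min 1 (w / τ) + sampleSize A τ := by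
  rw [sampleSize, Multiset.map_cons, Multiset.sum_cons, sampleSize]

theorem sampleSize_add {B : Multiset ℝ} :
    sampleSize (A + B) τ = sampleSize A τ + sampleSize B τ := by
  rw [sampleSize, Multiset.map_add, Multiset.sum_add, sampleSize, sampleSize]

theorem sampleSize_eq_card (hτ : 0 < τ) (h : ∀ a ∈ A, τ ≤ a) : sampleSize A τ = A.card := by
  have hone : ∀ a ∈ A, min 1 (a / τ) = 1 := fun a ha => min_eq_left ((one_le_div hτ).2 (h a ha))
  rw [sampleSize, Multiset.map_congr rfl hone, Multiset.map_const', Multiset.sum_replicate,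
    nsmul_one]

theorem sampleSize_eq_sum_div (hτ : 0 < τ) (h : ∀ a ∈ A, a ≤ τ) :
    sampleSize A τ = A.sum / τ := by
  have hdiv : ∀ a ∈ A, min 1 (a / τ) = id a / τ := fun a ha =>
    min_eq_right ((div_le_one hτ).2 (h a ha))
  rw [sampleSize, Multiset.map_congr rfl hdiv, Multiset.sum_map_div, Multiset.map_id]

theorem sampleSize_le_sum_div : sampleSize A τ ≤ A.sum / τ := by
  calc sampleSize A τ ≤ (A.map fun a => a / τ).sum :=
        Multiset.sum_map_le_sum_map _ _ fun a _ => min_le_right _ _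
    _ = A.sum / τ := by rw [Multiset.sum_map_div, Multiset.map_id']

theorem min_one_div_le_min_one_div (hw : 0 ≤ w) (hτ : 0 < τ) (h : τ ≤ τ') :
    min 1 (w / τ') ≤ min 1 (w / τ) :=
  min_le_min_left _ (div_le_div_of_nonneg_left hw hτ h)

theorem sampleSize_anti (hA : ∀ a ∈ A, 0 < a) (hτ : 0 < τ) (h : τ ≤ τ') :
    sampleSize A τ' ≤ sampleSize A τ :=
  Multiset.sum_map_le_sum_map _ _ fun a ha => min_one_div_le_min_one_div (hA a ha).le hτ h

theorem sampleSize_lt_sampleSize (hA : ∀ a ∈ A, 0 < a) (hτ : 0 < τ) (h : τ < τ')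
    (hlt : sampleSize A τ' < A.card) : sampleSize A τ' < sampleSize A τ := by
  have hτ' : 0 < τ' := hτ.trans h
  obtain ⟨a, ha, haτ'⟩ : ∃ a ∈ A, a < τ' := by
    by_contra! hall
    exact hlt.ne (sampleSize_eq_card hτ' hall)
  refine Multiset.sum_lt_sum
    (fun b hb => min_one_div_le_min_one_div (hA b hb).le hτ h.le) ⟨a, ha, ?_⟩
  rw [min_eq_right ((div_lt_one hτ').2 haτ').le]
  exact lt_min ((div_lt_one hτ').2 haτ') (div_lt_div_of_pos_left (hA a ha) hτ h)

theorem continuousOn_sampleSize (A : Multiset ℝ) : ContinuousOn (sampleSize A) (Set.Ioi 0) :=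
  continuousOn_multiset_sum A fun _ _ =>
    continuousOn_const.inf (continuousOn_const.div continuousOn_id fun _ hτ => ne_of_gt hτ)

/-- The value `τ` for which the expected sample size is `k`: the VarOpt threshold of the multiset
`A` of weights. -/
def IsThreshold (k : ℕ) (A : Multiset ℝ) (τ : ℝ) : Prop := 0 < τ ∧ sampleSize A τ = k

theorem isThreshold_iff (hτ : 0 < τ) : IsThreshold k A τ ↔
    ((k : ℝ) - (A.filter (τ < ·)).card) * τ + (A.filter (τ < ·)).sum = A.sum := by
  have hsum := congrArg Multiset.sum (Multiset.filter_add_not (τ < ·) A)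
  rw [Multiset.sum_add] at hsum
  have hsize : sampleSize A τ =
      (A.filter (τ < ·)).card + (A.filter (¬ τ < ·)).sum / τ := by
    conv_lhs => rw [← Multiset.filter_add_not (τ < ·) A]
    rw [sampleSize_add,
      sampleSize_eq_card hτ fun a ha => (Multiset.mem_filter.1 ha).2.le,
      sampleSize_eq_sum_div hτ fun a ha => not_lt.1 (Multiset.mem_filter.1 ha).2]
  rw [IsThreshold, hsize, and_iff_right hτ, ← eq_sub_iff_add_eq', div_eq_iff hτ.ne', ← hsum]
  constructor <;> intro h <;> linarith

theorem IsThreshold.le_of_le_sampleSize (h : IsThreshold k A τ) (hA : ∀ a ∈ A, 0 < a)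
    (hk : k < A.card) (hle : (k : ℝ) ≤ sampleSize A τ') : τ' ≤ τ := by
  by_contra! hlt
  have hcard : sampleSize A τ' < A.card :=
    ((sampleSize_anti hA h.1 hlt.le).trans_eq h.2).trans_lt (by exact_mod_cast hk)
  exact ((sampleSize_lt_sampleSize hA h.1 hlt hcard).trans_eq h.2).not_ge hle

theorem IsThreshold.unique (h : IsThreshold k A τ) (h' : IsThreshold k A τ')
    (hA : ∀ a ∈ A, 0 < a) (hk : k < A.card) : τ = τ' :=
  le_antisymm (h'.le_of_le_sampleSize hA hk h.2.ge) (h.le_of_le_sampleSize hA hk h'.2.ge)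

theorem exists_pos_forall_mem_le (hA : ∀ a ∈ A, 0 < a) : ∃ τ > 0, ∀ a ∈ A, τ ≤ a := by
  induction A using Multiset.induction with
  | empty => exact ⟨1, one_pos, by simp⟩
  | cons a A ih =>
    rw [Multiset.forall_mem_cons] at hA
    obtain ⟨τ, hτ, hle⟩ := ih hA.2
    refine ⟨min a τ, lt_min hA.1 hτ, Multiset.forall_mem_cons.2 ⟨min_le_left _ _, fun b hb => ?_⟩⟩
    exact (min_le_right _ _).trans (hle b hb)

theorem exists_isThreshold (hk : 1 ≤ k) (hkA : k ≤ A.card) (hA : ∀ a ∈ A, 0 < a) :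
    ∃ τ, IsThreshold k A τ := by
  obtain ⟨τ₀, hτ₀, hle⟩ := exists_pos_forall_mem_le hA
  have hk' : (0 : ℝ) < k := by exact_mod_cast hk
  have hcard : (k : ℝ) ≤ A.card := by exact_mod_cast hkA
  have hsum : A.card * τ₀ ≤ A.sum := by
    simpa only [nsmul_eq_mul] using Multiset.card_nsmul_le_sum hle
  have hτ₁ : τ₀ ≤ A.sum / k := by
    rw [le_div_iff₀ hk', mul_comm]
    exact (mul_le_mul_of_nonneg_right hcard hτ₀.le).trans hsum
  have hupper : (k : ℝ) ≤ sampleSize A τ₀ := by rwa [sampleSize_eq_card hτ₀ hle]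
  have hlower : sampleSize A (A.sum / k) ≤ k := by
    have hpos : 0 < A.sum / k := hτ₀.trans_le hτ₁
    refine sampleSize_le_sum_div.trans_eq ?_
    rw [div_div_cancel₀ (div_ne_zero_iff.1 hpos.ne').1]
  obtain ⟨τ, hτ, heq⟩ := intermediate_value_Icc' hτ₁
    ((continuousOn_sampleSize A).mono fun t ht => hτ₀.trans_le ht.1) ⟨hlower, hupper⟩
  exact ⟨τ, hτ₀.trans_le hτ.1, heq⟩

/-- The VarOpt threshold of `A` if there are more than `k` weights; otherwise, as long as the
reservoir can hold all items, the threshold of the algorithm is `0`. -/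
noncomputable def threshold (k : ℕ) (A : Multiset ℝ) : ℝ :=
  open Classical in if k < A.card then Classical.epsilon (IsThreshold k A) else 0

theorem threshold_of_card_le (h : A.card ≤ k) : threshold k A = 0 := if_neg h.not_gt

theorem isThreshold_threshold (hk : 1 ≤ k) (hkA : k < A.card) (hA : ∀ a ∈ A, 0 < a) :
    IsThreshold k A (threshold k A) := by
  rw [threshold, if_pos hkA]
  exact Classical.epsilon_spec (exists_isThreshold hk hkA.le hA)

theorem IsThreshold.threshold_eq (h : IsThreshold k A τ) (hA : ∀ a ∈ A, 0 < a) (hkA : k < A.card) :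
    threshold k A = τ := by
  rw [threshold, if_pos hkA]
  exact (Classical.epsilon_spec ⟨τ, h⟩ : IsThreshold k A _).unique h hA hkA

theorem threshold_nonneg (hk : 1 ≤ k) (hA : ∀ a ∈ A, 0 < a) : 0 ≤ threshold k A := by
  rcases le_or_gt A.card k with hle | hlt
  · exact (threshold_of_card_le hle).ge
  · exact (isThreshold_threshold hk hlt hA).1.le

theorem threshold_le_threshold_cons (hk : 1 ≤ k) (hA : ∀ a ∈ A, 0 < a) (hw : 0 < w) :
    threshold k A ≤ threshold k (w ::ₘ A) := by
  have hwA : ∀ a ∈ w ::ₘ A, 0 < a := Multiset.forall_mem_cons.2 ⟨hw, hA⟩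
  rcases le_or_gt A.card k with hle | hlt
  · exact (threshold_of_card_le hle).trans_le (threshold_nonneg hk hwA)
  · have hτ := isThreshold_threshold hk hlt hA
    have hlt' : k < (w ::ₘ A).card :=
      hlt.trans_le (Multiset.card_le_card (Multiset.le_cons_self A w))
    refine (isThreshold_threshold hk hlt' hwA).le_of_le_sampleSize hwA hlt' ?_
    rw [sampleSize_cons, hτ.2]
    exact le_add_of_nonneg_left (le_min zero_le_one (div_nonneg hw.le hτ.1.le))

end Threshold

section Inclusion

open MeasureTheory

variable {k : ℕ} {B : Multiset ℝ} {w : ℝ}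

/-- The event that the new item, of weight `w`, enters the reservoir in a round with random number
`u` after which `B` is the multiset of all weights that have arrived, including `w`. -/
def Included (k : ℕ) (B : Multiset ℝ) (w u : ℝ) : Prop :=
  threshold k B - w < u * threshold k B

/-- The probability of `Included k B w` for a uniformly random number. -/
noncomputable def inclProb (k : ℕ) (B : Multiset ℝ) (w : ℝ) : ℝ :=
  (volume.restrict (Set.Ioo (0 : ℝ) 1)).real {u | Included k B w u}

theorem measurableSet_included : MeasurableSet {u | Included k B w u} :=
  measurableSet_lt measurable_const (measurable_id.mul_const _)

instance isProbabilityMeasure_restrict_Ioo :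
    IsProbabilityMeasure (volume.restrict (Set.Ioo (0 : ℝ) 1)) :=
  ⟨by rw [Measure.restrict_apply_univ, Real.volume_Ioo, sub_zero, ENNReal.ofReal_one]⟩

theorem inclProb_le_one : inclProb k B w ≤ 1 := measureReal_le_one

theorem inclProb_le_div (hw : 0 ≤ w) (hτ : 0 < threshold k B) :
    inclProb k B w ≤ w / threshold k B := by
  have hsub : {u | Included k B w u} ∩ Set.Ioo 0 1 ⊆ Set.Ioo (1 - w / threshold k B) 1 := by
    rintro u ⟨hu, -, hu1⟩
    refine ⟨?_, hu1⟩
    rwa [Set.mem_ofPred_eq, Included, ← div_lt_iff₀ hτ, sub_div, div_self hτ.ne'] at hu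
  calc inclProb k B w = volume.real ({u | Included k B w u} ∩ Set.Ioo 0 1) :=
        measureReal_restrict_apply measurableSet_included
    _ ≤ volume.real (Set.Ioo (1 - w / threshold k B) 1) :=
        measureReal_mono hsub measure_Ioo_lt_top.ne
    _ = w / threshold k B := by
        have hdiv : 0 ≤ w / threshold k B := div_nonneg hw hτ.le
        rw [Real.volume_real_Ioo_of_le (by linarith), sub_sub_cancel]

theorem sum_inclProb_le (hk : 1 ≤ k) (hB : ∀ b ∈ B, 0 < b) :
    (B.map (inclProb k B)).sum ≤ min (k : ℝ) B.card := by
  have hcard : (B.map (inclProb k B)).sum ≤ B.card := by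
    simpa only [Multiset.map_const', Multiset.sum_replicate, nsmul_one] using
      Multiset.sum_map_le_sum_map (inclProb k B) (fun _ => (1 : ℝ)) fun b _ => inclProb_le_one
  refine le_min ?_ hcard
  rcases le_or_gt B.card k with hle | hlt
  · exact hcard.trans (by exact_mod_cast hle)
  · have hτ := isThreshold_threshold hk hlt hB
    rw [← hτ.2]
    exact Multiset.sum_map_le_sum_map _ _ fun b hb =>
      le_min inclProb_le_one (inclProb_le_div (hB b hb).le hτ.1)

end Inclusion

/-! ### The state of the reservoir -/

/-- The invariant of the data structures of the reservoir. -/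
structure State.WellFormed (s : State) : Prop where
  isAVL_large : s.large.IsAVL
  isAVL_small : s.small.IsAVL
  sorted : s.large.weights.SortedLE
  minLarge_eq : s.minLarge = s.large.weights.head?

/-- The reservoir `s` of capacity `k` is a VarOpt sample of items whose weights form the multiset
`A`. The sampled small items need no description: each of them counts with the threshold as its
adjusted weight. -/
structure State.Represents (s : State) (k : ℕ) (A : Multiset ℝ) : Prop extends s.WellFormed where
  τ_eq : s.τ = threshold k A
  large_eq : (s.large.weights : Multiset ℝ) = A.filter (s.τ < ·)
  card_eq : s.large.size + s.small.size = min k A.card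

namespace State.Represents

variable {s : State} {k : ℕ} {A : Multiset ℝ}

theorem large_size_eq (h : s.Represents k A) : s.large.size = (A.filter (s.τ < ·)).card := by
  rw [← h.large_eq, Multiset.coe_card, h.isAVL_large.size_eq]

theorem τ_lt_of_mem (h : s.Represents k A) {v : ℝ} (hv : v ∈ s.large.weights) : s.τ < v := by
  rw [← Multiset.mem_coe, h.large_eq] at hv
  exact (Multiset.mem_filter.1 hv).2

theorem τ_nonneg (h : s.Represents k A) (hk : 1 ≤ k) (hA : ∀ a ∈ A, 0 < a) : 0 ≤ s.τ :=
  h.τ_eq ▸ threshold_nonneg hk hA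

theorem τ_eq_zero (h : s.Represents k A) (hkA : A.card ≤ k) : s.τ = 0 :=
  h.τ_eq.trans (threshold_of_card_le hkA)

theorem small_size_eq_zero (h : s.Represents k A) (hA : ∀ a ∈ A, 0 < a) (hτ : s.τ = 0) :
    s.small.size = 0 := by
  have hlarge := h.large_size_eq
  rw [hτ, Multiset.filter_eq_self.2 hA] at hlarge
  have := h.card_eq
  omega

theorem total_eq (h : s.Represents k A) (hk : 1 ≤ k) (hA : ∀ a ∈ A, 0 < a) :
    s.small.size * s.τ + s.large.weights.sum = A.sum := by
  rw [← Multiset.sum_coe, h.large_eq]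
  rcases le_or_gt A.card k with hle | hlt
  · rw [h.τ_eq_zero hle, mul_zero, zero_add, Multiset.filter_eq_self.2 hA]
  · have hτ : IsThreshold k A s.τ := h.τ_eq ▸ isThreshold_threshold hk hlt hA
    rw [← (isThreshold_iff hτ.1).1 hτ, ← h.large_size_eq]
    have hcard : (s.large.size : ℝ) + s.small.size = k := by
      exact_mod_cast h.card_eq.trans (min_eq_left hlt.le)
    rw [← hcard, add_sub_cancel_left]

theorem of_total_eq (hs : s.WellFormed) (hA : ∀ a ∈ A, 0 < a) (hkA : k < A.card) (hτ : 0 < s.τ)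
    (hlarge : (s.large.weights : Multiset ℝ) = A.filter (s.τ < ·))
    (hcard : s.large.size + s.small.size = k)
    (htotal : s.small.size * s.τ + s.large.weights.sum = A.sum) : s.Represents k A := by
  have hthreshold : IsThreshold k A s.τ := by
    rw [isThreshold_iff hτ, ← hlarge, Multiset.coe_card, ← hs.isAVL_large.size_eq,
      Multiset.sum_coe, ← htotal, ← hcard, Nat.cast_add, add_sub_cancel_left]
  exact ⟨hs, (hthreshold.threshold_eq hA hkA).symm, hlarge, by omega⟩

theorem init (k : ℕ) : State.init.Represents k 0 where
  isAVL_large := trivial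
  isAVL_small := trivial
  sorted := List.Pairwise.nil.sortedLE
  minLarge_eq := rfl
  τ_eq := (threshold_of_card_le (Nat.zero_le k)).symm
  large_eq := (Multiset.filter_zero _).symm
  card_eq := (min_eq_right (Nat.zero_le k)).symm

end State.Represents

section NewThreshold

variable {ρ s τ : ℝ} {c : ℕ} {a b : List ℝ}

/-- The candidates for the reservoir in the order of `slowStep`: `c` items of total adjusted weight
`s`, followed by the large items, whose weights form the list `l`. The number `ρ` is a lower bound
for the new threshold. -/
structure Candidates (ρ : ℝ) (c : ℕ) (s : ℝ) (l : List ℝ) : Prop where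
  sorted : l.SortedLE
  nonneg : 0 ≤ s
  pos_of_ne_zero : c ≠ 0 → 0 < s
  mul_le : ((c : ℝ) - 1) * ρ ≤ s
  le_of_mem : ∀ v ∈ l, ρ ≤ v
  pos_of_mem : ∀ v ∈ l, 0 < v

theorem Candidates.two_le_add_length (h : Candidates ρ c s (a ++ b))
    (hlen : 2 ≤ c + (a ++ b).length)
    (hb : ∀ v ∈ b.head?, s + a.sum < (((c + a.length : ℕ) : ℝ) - 1) * v) : 2 ≤ c + a.length := by
  by_contra! hlt
  have hsum : 0 ≤ s + a.sum := add_nonneg h.nonneg <|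
    List.sum_nonneg fun v hv => (h.pos_of_mem v (List.mem_append_left b hv)).le
  obtain ⟨v, b', rfl⟩ : ∃ v b', b = v :: b' := by
    refine List.exists_cons_of_ne_nil ?_
    rintro rfl
    rw [List.append_nil] at hlen
    omega
  have hv : 0 < v := h.pos_of_mem v (List.mem_append_right a List.mem_cons_self)
  have hcoef : ((c + a.length : ℕ) : ℝ) - 1 ≤ 0 := by
    rw [sub_nonpos]
    exact_mod_cast Nat.le_of_lt_succ hlt
  exact (hb v rfl).not_ge ((mul_nonpos_of_nonpos_of_nonneg hcoef hv.le).trans hsum)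

theorem Candidates.sum_pos (h : Candidates ρ c s (a ++ b)) (hlen : 2 ≤ c + a.length) :
    0 < s + a.sum := by
  cases a with
  | nil =>
    rw [List.sum_nil, add_zero]
    exact h.pos_of_ne_zero (by rw [List.length_nil] at hlen; omega)
  | cons v a' =>
    refine add_pos_of_nonneg_of_pos h.nonneg (List.sum_pos _ (fun y hy => ?_) (by simp))
    exact h.pos_of_mem y (List.mem_append_left b hy)

theorem Candidates.le_newThreshold (h : Candidates ρ c s (a ++ b)) (hlen : 2 ≤ c + a.length)
    (hτ : (((c + a.length : ℕ) : ℝ) - 1) * τ = s + a.sum) : ρ ≤ τ := by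
  have hcoef : 0 < ((c + a.length : ℕ) : ℝ) - 1 := by
    rw [sub_pos]
    exact_mod_cast hlen
  have hsum : a.length * ρ ≤ a.sum := by
    simpa only [nsmul_eq_mul] using
      List.card_nsmul_le_sum a ρ fun v hv => h.le_of_mem v (List.mem_append_left b hv)
  refine le_of_mul_le_mul_left ?_ hcoef
  calc (((c + a.length : ℕ) : ℝ) - 1) * ρ = ((c : ℝ) - 1) * ρ + a.length * ρ := by
        push_cast
        ring
    _ ≤ s + a.sum := add_le_add h.mul_le hsum
    _ = (((c + a.length : ℕ) : ℝ) - 1) * τ := hτ.symm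

/-- The number `τ` is the new threshold for the candidates `c`, `s`, `a ++ b` of `Candidates`, of
which those in `a` lie up to `τ` and those in `b` above `τ`. -/
structure IsNewThreshold (ρ : ℝ) (c : ℕ) (s : ℝ) (a b : List ℝ) (τ : ℝ) : Prop where
  pos : 0 < τ
  mul_eq : (((c + a.length : ℕ) : ℝ) - 1) * τ = s + a.sum
  le : ρ ≤ τ
  le_of_mem : ∀ v ∈ a, v ≤ τ
  lt_of_mem : ∀ v ∈ b, τ < v

theorem Candidates.isNewThreshold (h : Candidates ρ c s (a ++ b))
    (hlen : 2 ≤ c + (a ++ b).length)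
    (ha : ∀ v ∈ a.getLast?, (((c + a.length : ℕ) : ℝ) - 1) * v ≤ s + a.sum)
    (hb : ∀ v ∈ b.head?, s + a.sum < (((c + a.length : ℕ) : ℝ) - 1) * v) :
    IsNewThreshold ρ c s a b ((s + a.sum) / (((c + a.length : ℕ) : ℝ) - 1)) := by
  obtain ⟨hsorted_a, hsorted_b, -⟩ := sortedLE_append.1 h.sorted
  have htwo := h.two_le_add_length hlen hb
  have hcoef : 0 < ((c + a.length : ℕ) : ℝ) - 1 := by
    rw [sub_pos]
    exact_mod_cast htwo
  have hmul := mul_div_cancel₀ (s + a.sum) hcoef.ne'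
  refine ⟨div_pos (h.sum_pos htwo) hcoef, hmul, h.le_newThreshold htwo hmul, fun v hv => ?_,
    fun v hv => ?_⟩
  · obtain ⟨v', hv', hle⟩ := exists_mem_getLast?_ge hsorted_a hv
    exact hle.trans ((le_div_iff₀' hcoef).2 (ha v' hv'))
  · obtain ⟨v', hv', hle⟩ := exists_mem_head?_le hsorted_b hv
    exact ((div_lt_iff₀' hcoef).2 (hb v' hv')).trans_le hle

end NewThreshold

section SlowStep

variable {k : ℕ} {A : Multiset ℝ} {s : State} {x : Item} {u : ℝ} {light : Bool}

/-- The condition on the reservoir `s` under which a new item of weight `w` may be placed first in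
the order (`light = true`) or into the tree of large items (`light = false`). If it is placed first
without being the smallest, then the inequality keeps its weight below the new threshold. -/
def State.Admits (s : State) (w : ℝ) : Bool → Prop
  | true => s.small.size * w ≤ w + s.small.size * s.τ ∧ ∀ v ∈ s.large.weights, w ≤ v
  | false => s.τ < w

/-- The tree of large items with the new item `x` inserted, unless `x` is light. -/
noncomputable def insertHeavy (light : Bool) (x : Item) (L : Tree) : Timed Tree :=
  if light then pure L else Tree.insertSorted x L

theorem isAVL_insertHeavy_and_height_insertHeavy_le {L : Tree} (hL : L.IsAVL) :
    (insertHeavy light x L).val.IsAVL ∧ (insertHeavy light x L).val.height ≤ L.height + 1 := by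
  cases light with
  | true => exact ⟨hL, Nat.le_succ _⟩
  | false => exact Tree.isAVL_insertSorted_and_height_insertSorted_le hL

theorem steps_insertHeavy_le {L : Tree} (hL : L.IsAVL) :
    (insertHeavy light x L).steps ≤ 8 * L.height + 5 := by
  cases light with
  | true => exact Nat.zero_le _
  | false => exact Tree.steps_insertSorted_le hL

theorem sorted_insertHeavy {L : Tree} (hL : L.IsAVL) (hs : L.weights.SortedLE) :
    (insertHeavy light x L).val.weights.SortedLE := by
  cases light with
  | true => exact hs
  | false => exact Tree.sortedLE_weights_insertSorted hL hs

theorem coe_weights_insertHeavy {L : Tree} (hL : L.IsAVL) (hs : L.weights.SortedLE) :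
    ((insertHeavy light x L).val.weights : Multiset ℝ) =
      (if light then 0 else {x.weight}) + (L.weights : Multiset ℝ) := by
  cases light with
  | true => exact (zero_add _).symm
  | false => exact Tree.coe_weights_insertSorted hL hs

/-- The number of candidates outside the tree of large items. -/
def outsideCount (s : State) (light : Bool) : ℕ := (if light then 1 else 0) + s.small.size

/-- The total adjusted weight of the candidates outside the tree of large items. -/
noncomputable def outsideWeight (s : State) (x : Item) (light : Bool) : ℝ :=
  (if light then x.weight else 0) + s.small.size * s.τ

/-- A lower bound for the adjusted weights of the large candidates and for the new threshold. -/
noncomputable def candidateBound (s : State) (x : Item) (light : Bool) : ℝ :=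
  if light then max s.τ x.weight else s.τ

theorem τ_le_candidateBound : s.τ ≤ candidateBound s x light := by
  cases light with
  | true => exact le_max_left _ _
  | false => exact le_rfl

theorem State.Represents.candidates (h : s.Represents k A) (hk : 1 ≤ k) (hA : ∀ a ∈ A, 0 < a)
    (hx : 0 < x.weight) (hadm : s.Admits x.weight light) :
    Candidates (candidateBound s x light) (outsideCount s light) (outsideWeight s x light)
      (insertHeavy light x s.large).val.weights := by
  have hτ := h.τ_nonneg hk hA
  have hsmall : 0 ≤ s.small.size * s.τ := mul_nonneg (Nat.cast_nonneg _) hτ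
  have hmem (v : ℝ) : v ∈ (insertHeavy light x s.large).val.weights ↔
      v ∈ (if light then (0 : Multiset ℝ) else {x.weight}) ∨ v ∈ s.large.weights := by
    rw [← Multiset.mem_coe, coe_weights_insertHeavy h.isAVL_large h.sorted, Multiset.mem_add,
      Multiset.mem_coe]
  have hsorted := sorted_insertHeavy (light := light) (x := x) h.isAVL_large h.sorted
  cases light with
  | true =>
    obtain ⟨hmul, hle⟩ := hadm
    have hpos : 0 < x.weight + s.small.size * s.τ := add_pos_of_pos_of_nonneg hx hsmall
    refine ⟨hsorted, hpos.le, fun _ => hpos, ?_, fun v hv => ?_, fun v hv => ?_⟩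
    · rw [outsideCount, if_pos rfl, Nat.cast_add, Nat.cast_one, add_sub_cancel_left,
        candidateBound, if_pos rfl, mul_max_of_nonneg _ _ (Nat.cast_nonneg _)]
      exact max_le (le_add_of_nonneg_left hx.le) hmul
    · exact max_le (h.τ_lt_of_mem hv).le (hle v hv)
    · exact hτ.trans_lt (h.τ_lt_of_mem hv)
  | false =>
    have hlt (v : ℝ) (hv : v ∈ (insertHeavy false x s.large).val.weights) : s.τ < v := by
      rcases (hmem v).1 hv with hv | hv
      · exact (Multiset.mem_singleton.1 hv).symm ▸ hadm
      · exact h.τ_lt_of_mem hv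
    have hweight : outsideWeight s x false = s.small.size * s.τ := zero_add _
    have hcount : outsideCount s false = s.small.size := zero_add _
    rw [hweight, hcount]
    refine ⟨hsorted, hsmall, fun hne => ?_, ?_, fun v hv => (hlt v hv).le,
      fun v hv => hτ.trans_lt (hlt v hv)⟩
    · refine mul_pos (by exact_mod_cast Nat.pos_of_ne_zero hne) (hτ.lt_of_ne fun h0 => ?_)
      exact hne (h.small_size_eq_zero hA h0.symm)
    · exact mul_le_mul_of_nonneg_right (sub_le_self _ zero_le_one) hτ

theorem filter_lt_filter_lt {τ τ' : ℝ} (h : τ ≤ τ') :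
    (A.filter (τ < ·)).filter (τ' < ·) = A.filter (τ' < ·) := by
  rw [Multiset.filter_filter]
  exact Multiset.filter_congr fun v _ => and_iff_left_of_imp h.trans_lt

theorem filter_weights_insertHeavy (h : s.Represents k A) {τ : ℝ}
    (hτ : candidateBound s x light ≤ τ) :
    ((insertHeavy light x s.large).val.weights : Multiset ℝ).filter (τ < ·) =
      (x.weight ::ₘ A).filter (τ < ·) := by
  rw [coe_weights_insertHeavy h.isAVL_large h.sorted, h.large_eq, Multiset.filter_add,
    filter_lt_filter_lt (τ_le_candidateBound.trans hτ)]
  cases light with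
  | true =>
    rw [if_pos rfl, Multiset.filter_zero, zero_add, Multiset.filter_cons_of_neg]
    exact not_lt.2 ((le_max_right _ _).trans hτ)
  | false => rw [if_neg Bool.false_ne_true, ← Multiset.filter_add, Multiset.singleton_add]

theorem outsideCount_add_length (h : s.Represents k A) (hkA : k ≤ A.card) :
    outsideCount s light + (insertHeavy light x s.large).val.weights.length = k + 1 := by
  have hlength := congrArg Multiset.card
    (coe_weights_insertHeavy (light := light) (x := x) h.isAVL_large h.sorted)
  rw [Multiset.card_add, Multiset.coe_card, Multiset.coe_card, ← h.isAVL_large.size_eq] at hlength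
  have hcard := h.card_eq.trans (min_eq_left hkA)
  cases light with
  | true => rw [hlength, outsideCount, if_pos rfl, if_pos rfl, Multiset.card_zero]; omega
  | false =>
    rw [hlength, outsideCount, if_neg Bool.false_ne_true, if_neg Bool.false_ne_true,
      Multiset.card_singleton]
    omega

theorem outsideWeight_add_sum (h : s.Represents k A) (hk : 1 ≤ k) (hA : ∀ a ∈ A, 0 < a) :
    outsideWeight s x light + (insertHeavy light x s.large).val.weights.sum =
      (x.weight ::ₘ A).sum := by
  rw [← Multiset.sum_coe, coe_weights_insertHeavy h.isAVL_large h.sorted, Multiset.sum_add,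
    Multiset.sum_cons, ← h.total_eq hk hA, Multiset.sum_coe, outsideWeight]
  cases light with
  | true => simp only [if_true, Multiset.sum_zero]; ring
  | false => simp only [Bool.false_eq_true, if_false, Multiset.sum_singleton]; ring

theorem State.Represents.of_split {s' : State} {a b : List ℝ} (h : s.Represents k A) (hk : 1 ≤ k)
    (hA : ∀ a ∈ A, 0 < a) (hkA : k ≤ A.card) (hx : 0 < x.weight) (hs' : s'.WellFormed)
    (hab : (insertHeavy light x s.large).val.weights = a ++ b)
    (hlarge : s'.large.weights = b) (hsmall : s'.small.size + 1 = outsideCount s light + a.length)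
    (hτ : 0 < s'.τ) (hbound : candidateBound s x light ≤ s'.τ) (ha : ∀ v ∈ a, v ≤ s'.τ)
    (hb : ∀ v ∈ b, s'.τ < v) (htotal : s'.small.size * s'.τ = outsideWeight s x light + a.sum) :
    s'.Represents k (x.weight ::ₘ A) := by
  have hlength := outsideCount_add_length (light := light) (x := x) h hkA
  have hsum := outsideWeight_add_sum (light := light) (x := x) h hk hA
  rw [hab, List.length_append] at hlength
  rw [hab, List.sum_append] at hsum
  refine .of_total_eq hs' (Multiset.forall_mem_cons.2 ⟨hx, hA⟩) ?_ hτ ?_ ?_ ?_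
  · rw [Multiset.card_cons]
    exact Nat.lt_succ_of_le hkA
  · rw [← filter_weights_insertHeavy h hbound, hab, ← Multiset.coe_add, Multiset.filter_add,
      Multiset.filter_eq_nil.2 fun v hv => not_lt.2 (ha v hv), zero_add,
      Multiset.filter_eq_self.2 hb, hlarge]
  · rw [hs'.isAVL_large.size_eq, hlarge]
    omega
  · rw [htotal, hlarge, ← hsum, add_assoc]

end SlowStep

/-! ### The general round -/

section SlowStep

/-- Search for the item to be dropped and delete it. -/
noncomputable def searchDelete (goRight : ℕ → ℝ → ℝ → Prop) [∀ c s v, Decidable (goRight c s v)]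
    (t : Tree) : Timed Tree := do
  let d ← Tree.search goRight t 0 0
  Tree.deleteAt d.1 t

section SearchDelete

variable {goRight : ℕ → ℝ → ℝ → Prop} [∀ c s v, Decidable (goRight c s v)] {t : Tree}

theorem isAVL_searchDelete_and_height_searchDelete_le (ht : t.IsAVL) :
    (searchDelete goRight t).val.IsAVL ∧ (searchDelete goRight t).val.height ≤ t.height + 1 :=
  Tree.isAVL_deleteAt_and_height_deleteAt_le _ ht

theorem steps_searchDelete_le (ht : t.IsAVL) :
    (searchDelete goRight t).steps ≤ 19 * t.height + 10 := by
  have hsearch := Tree.steps_search_le (goRight := goRight) (c := 0) (s := 0) ht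
  have hdelete := Tree.steps_deleteAt_le (Tree.search goRight t 0 0).val.1 ht
  rw [searchDelete, Timed.steps_bind]
  omega

theorem exists_weights_searchDelete {a b : List ℝ} (ht : t.IsAVL) (hab : t.weights = a ++ b)
    (ha : a ≠ [])
    (hlt : ∀ l, l <+: t.weights → ∀ v, goRight l.length l.sum v → l.length < a.length) :
    ∃ a', (searchDelete goRight t).val.weights = a' ++ b ∧ a'.length + 1 = a.length := by
  obtain ⟨l, r, hlr, hval, hend⟩ := Tree.exists_isStop_search goRight ht 0 0
  have hl : l.length < a.length := by
    rcases eq_or_ne l [] with rfl | hne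
    · exact List.length_pos_of_ne_nil ha
    · have hlast := hend.last (l.getLast hne) (List.getLast?_eq_getLast_of_ne_nil hne)
      rw [zero_add, zero_add] at hlast
      exact hlt l ⟨r, hlr.symm⟩ _ hlast
  refine ⟨a.eraseIdx l.length, ?_, ?_⟩
  · rw [searchDelete, Timed.val_bind, hval, zero_add, Tree.weights_deleteAt _ ht, hab,
      ← List.eraseIdx_eq_take_drop_succ, List.eraseIdx_append_of_lt_length hl]
  · rw [List.length_eraseIdx_of_lt hl]
    omega

end SearchDelete

/-- The tree of small items, with the new item `x` added, if `x` is light. -/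
noncomputable def appendLight (light : Bool) (x : Item) (T : Tree) : Timed Tree :=
  if light then Tree.join T x Tree.leaf else pure T

section AppendLight

variable {light : Bool} {x : Item} {T : Tree}

theorem isAVL_appendLight (hT : T.IsAVL) : (appendLight light x T).val.IsAVL := by
  cases light with
  | true => exact Tree.isAVL_join hT Tree.isAVL_leaf
  | false => exact hT

theorem length_weights_appendLight :
    (appendLight light x T).val.weights.length = T.weights.length + if light then 1 else 0 := by
  cases light with
  | true =>
    rw [appendLight, if_pos rfl, if_pos rfl, Tree.weights_join, Tree.weights_leaf,
      List.length_append, List.length_singleton]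
  | false => rfl

theorem steps_appendLight_le (hT : T.IsAVL) :
    (appendLight light x T).steps ≤ T.height + 2 := by
  cases light with
  | true =>
    have hjoin := Tree.steps_join_add_min_le (x := x) hT Tree.isAVL_leaf
    rw [Tree.height_leaf] at hjoin
    rw [appendLight, if_pos rfl]
    omega
  | false => exact Nat.zero_le _

end AppendLight

/-- The state with threshold `τ` obtained from the trees `T` and `L` of small and large items, after
the item to be dropped has been deleted, when the first `m` items of `L` become small, as well as
`x`, if `x` is light. -/
noncomputable def settle (light : Bool) (x : Item) (τ : ℝ) (T L : Tree) (m : ℕ) : Timed State := do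
  let q ← Tree.splitAt m L
  let T₁ ← Tree.concat T q.1
  let T₂ ← appendLight light x T₁
  let minLarge ← Tree.firstWeight q.2
  pure ⟨q.2, T₂, τ, minLarge⟩

section Settle

variable {light : Bool} {x : Item} {τ : ℝ} {T L : Tree} {a b : List ℝ}

theorem weights_large_settle (hL : L.IsAVL) (hab : L.weights = a ++ b) :
    (settle light x τ T L a.length).val.large.weights = b := by
  change (Tree.splitAt a.length L).val.2.weights = b
  rw [(Tree.weights_splitAt a.length hL).2, hab, List.drop_left]

theorem wellFormed_settle (hT : T.IsAVL) (hL : L.IsAVL) (hab : L.weights = a ++ b)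
    (hb : b.SortedLE) : (settle light x τ T L a.length).val.WellFormed := by
  have hsplit := (Tree.isAVL_splitAt_and_height_splitAt_le a.length hL).1
  have hconcat := (Tree.isAVL_concat_and_height_concat_le hT hsplit.1).1
  refine ⟨hsplit.2, isAVL_appendLight hconcat, ?_, Tree.firstWeight_eq_head? _⟩
  rwa [weights_large_settle hL hab]

theorem size_small_settle (hT : T.IsAVL) (hL : L.IsAVL) (hab : L.weights = a ++ b) :
    (settle light x τ T L a.length).val.small.size =
      T.size + a.length + if light then 1 else 0 := by
  have hsplit := Tree.isAVL_splitAt_and_height_splitAt_le a.length hL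
  have hconcat := Tree.isAVL_concat_and_height_concat_le hT hsplit.1.1
  change (appendLight light x _).val.size = _
  rw [(isAVL_appendLight hconcat.1).size_eq, length_weights_appendLight, Tree.weights_concat,
    (Tree.weights_splitAt a.length hL).1, hab, List.take_left, List.length_append, hT.size_eq]

theorem steps_settle_le {H m : ℕ} (hT : T.IsAVL) (hL : L.IsAVL) (hTH : T.height ≤ H)
    (hLH : L.height ≤ H) : (settle light x τ T L m).steps ≤ 15 * H + 10 := by
  obtain ⟨hsplit, hheight⟩ := Tree.isAVL_splitAt_and_height_splitAt_le m hL
  have hconcat := Tree.isAVL_concat_and_height_concat_le hT hsplit.1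
  have hsplit_steps := Tree.steps_splitAt_le m hL
  have hconcat_steps := Tree.steps_concat_le hT hsplit.1
  have happend_steps := steps_appendLight_le (light := light) (x := x) hconcat.1
  have hfirst_steps := Tree.steps_firstWeight_le hsplit.2
  simp only [settle, Timed.steps_bind, Timed.steps_pure]
  omega

end Settle

end SlowStep

section SlowStep

variable {s : State} {x : Item} {u τ : ℝ} {light : Bool} {L : Tree} {a b : List ℝ}

/-- The tree of small items without the one that `slowStep` drops at threshold `τ`, when it drops a
small item. -/
noncomputable def dropSmall (s : State) (x : Item) (u : ℝ) (light : Bool) (τ : ℝ) : Timed Tree :=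
  searchDelete (fun c _ _ => (((if light then 1 else 0) + c : ℕ) : ℝ) * τ -
    ((if light then x.weight else 0) + c * s.τ) < u * τ) s.small

/-- The tree `L` of large candidates, of which the first `m` lie up to the new threshold `τ`,
without the one that `slowStep` drops, when it drops an item of `L`. -/
noncomputable def dropLarge (s : State) (x : Item) (u : ℝ) (light : Bool) (τ : ℝ) (L : Tree)
    (m : ℕ) : Timed Tree :=
  searchDelete (fun c S _ => outsideCount s light + c ≤ outsideCount s light + m ∧
    ((outsideCount s light + c : ℕ) : ℝ) * τ - (outsideWeight s x light + S) < u * τ) L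

/-- The part of `slowStep` that follows the computation of the new threshold `τ`, up to which the
first `m` items of the tree `L` of large candidates lie. -/
noncomputable def dropAndSettle (s : State) (x : Item) (u : ℝ) (light : Bool) (τ : ℝ) (L : Tree)
    (m : ℕ) : Timed State :=
  if light = true ∧ u * τ ≤ τ - x.weight then settle false x τ s.small L m
  else if u * τ ≤ outsideCount s light * τ - outsideWeight s x light then do
    let T ← dropSmall s x u light τ
    settle light x τ T L m
  else do
    let L' ← dropLarge s x u light τ L m
    settle light x τ s.small L' (m - 1)

theorem slowStep_eq (s : State) (x : Item) (u : ℝ) (light : Bool) :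
    slowStep s x u light = (do
      tick
      let L ← insertHeavy light x s.large
      let p ← Tree.search (fun c S v => (((outsideCount s light + c : ℕ) : ℝ) - 1) * v ≤
        outsideWeight s x light + S) L 0 0
      dropAndSettle s x u light ((outsideWeight s x light + p.2) /
        (((outsideCount s light + p.1 : ℕ) : ℝ) - 1)) L p.1) := by
  simp only [slowStep, dropAndSettle, dropSmall, dropLarge, settle, searchDelete, insertHeavy,
    appendLight, outsideCount, outsideWeight, bind_assoc, pure_bind]
  cases light <;> simp only [reduceIte, Bool.false_eq_true, pure_bind]

theorem steps_dropAndSettle_le {H m : ℕ} (hs : s.WellFormed) (hL : L.IsAVL)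
    (hTH : s.small.height ≤ H) (hLH : L.height ≤ H) :
    (dropAndSettle s x u light τ L m).steps ≤ 34 * H + 35 := by
  rw [dropAndSettle]
  split_ifs
  · exact (steps_settle_le hs.isAVL_small hL hTH hLH).trans (by omega)
  · obtain ⟨hT', hheight⟩ : (dropSmall s x u light τ).val.IsAVL ∧ _ :=
      isAVL_searchDelete_and_height_searchDelete_le hs.isAVL_small
    have hdrop : (dropSmall s x u light τ).steps ≤ _ := steps_searchDelete_le hs.isAVL_small
    have hsettle := steps_settle_le (light := light) (x := x) (τ := τ) (m := m) (H := H + 1)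
      hT' hL (hheight.trans (by omega)) (by omega)
    rw [Timed.steps_bind]
    omega
  · obtain ⟨hL', hheight⟩ : (dropLarge s x u light τ L m).val.IsAVL ∧ _ :=
      isAVL_searchDelete_and_height_searchDelete_le hL
    have hdrop : (dropLarge s x u light τ L m).steps ≤ _ := steps_searchDelete_le hL
    have hsettle := steps_settle_le (light := light) (x := x) (τ := τ) (m := m - 1) (H := H + 1)
      hs.isAVL_small hL' (by omega) (hheight.trans (by omega))
    rw [Timed.steps_bind]
    omega

theorem steps_slowStep_le {H : ℕ} (hs : s.WellFormed) (hTH : s.small.height ≤ H)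
    (hLH : s.large.height ≤ H) : (slowStep s x u light).steps ≤ 43 * H + 77 := by
  obtain ⟨hL, hLheight⟩ :=
    isAVL_insertHeavy_and_height_insertHeavy_le (light := light) (x := x) hs.isAVL_large
  have hinsert := steps_insertHeavy_le (light := light) (x := x) hs.isAVL_large
  have hsearch := Tree.steps_search_le (goRight := fun c S v =>
    (((outsideCount s light + c : ℕ) : ℝ) - 1) * v ≤ outsideWeight s x light + S)
    (c := 0) (s := 0) hL
  have hdrop (τ : ℝ) (m : ℕ) := steps_dropAndSettle_le (x := x) (u := u) (light := light)
    (τ := τ) (m := m) (H := H + 1) hs hL (by omega) (by omega)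
  rw [slowStep_eq]
  simp only [Timed.steps_bind, Timed.steps_tick]
  calc _ ≤ 1 + ((8 * H + 5) + ((H + 2) + (34 * (H + 1) + 35))) := by
        gcongr
        · omega
        · omega
        · exact hdrop _ _
    _ = 43 * H + 77 := by ring

theorem size_dropSmall (hs : s.WellFormed) (hu : 0 < u * τ)
    (hnew : ¬ (light = true ∧ u * τ ≤ τ - x.weight))
    (hsmall : u * τ ≤ outsideCount s light * τ - outsideWeight s x light) :
    (dropSmall s x u light τ).val.size + 1 = s.small.size := by
  have hAVL := hs.isAVL_small
  have hdrop : (dropSmall s x u light τ).val.IsAVL :=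
    (isAVL_searchDelete_and_height_searchDelete_le hAVL).1
  rw [hdrop.size_eq, hAVL.size_eq]
  have hne : s.small.weights ≠ [] := by
    rw [← List.length_pos_iff_ne_nil, ← hAVL.size_eq]
    by_contra! hzero
    rw [outsideCount, outsideWeight, Nat.le_zero.1 hzero] at hsmall
    cases light with
    | true => exact hnew ⟨rfl, by simpa using hsmall⟩
    | false => exact hu.not_ge (by simpa using hsmall)
  obtain ⟨a', ha', hlength⟩ : ∃ a', (dropSmall s x u light τ).val.weights = a' ++ [] ∧ _ :=
    exists_weights_searchDelete hAVL (List.append_nil _).symm hne fun l hl _ hlt =>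
      hl.length_le.lt_of_ne fun heq => by
        rw [heq, ← hAVL.size_eq] at hlt
        exact hlt.not_ge hsmall
  rw [ha', List.append_nil, hlength]

theorem exists_weights_dropLarge (hL : L.IsAVL) (hab : L.weights = a ++ b)
    (hu : u ∈ Set.Ioo 0 1) (hτ : 0 < τ)
    (hsum : (((outsideCount s light + a.length : ℕ) : ℝ) - 1) * τ =
      outsideWeight s x light + a.sum)
    (hsmall : ¬ u * τ ≤ outsideCount s light * τ - outsideWeight s x light) :
    ∃ a', (dropLarge s x u light τ L a.length).val.weights = a' ++ b ∧
      a'.length + 1 = a.length := by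
  have huτ : u * τ < τ := mul_lt_of_lt_one_left hτ hu.2
  refine exists_weights_searchDelete hL hab ?_ ?_
  · rintro rfl
    rw [List.length_nil, add_zero, List.sum_nil] at hsum
    linarith
  · rintro l hl v ⟨hle, hlt⟩
    refine (Nat.add_le_add_iff_left.1 hle).lt_of_ne fun heq => ?_
    have hla : l = a := by
      rw [hab] at hl
      exact (List.prefix_of_prefix_length_le hl (List.prefix_append a b) heq.le).eq_of_length heq
    rw [hla] at hlt
    linarith

theorem exists_dropAndSettle_eq_settle (hs : s.WellFormed) (hL : L.IsAVL)
    (hab : L.weights = a ++ b) (hu : u ∈ Set.Ioo 0 1) (hτ : 0 < τ)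
    (hsum : (((outsideCount s light + a.length : ℕ) : ℝ) - 1) * τ =
      outsideWeight s x light + a.sum) :
    ∃ (light' : Bool) (T' L' : Tree) (a' : List ℝ), T'.IsAVL ∧ L'.IsAVL ∧ L'.weights = a' ++ b ∧
      T'.size + a'.length + (if light' then 1 else 0) + 1 = outsideCount s light + a.length ∧
      (dropAndSettle s x u light τ L a.length).val = (settle light' x τ T' L' a'.length).val := by
  rw [dropAndSettle]
  by_cases hnew : light = true ∧ u * τ ≤ τ - x.weight
  · rw [if_pos hnew]
    refine ⟨false, s.small, L, a, hs.isAVL_small, hL, hab, ?_, rfl⟩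
    rw [outsideCount, if_pos hnew.1, if_neg Bool.false_ne_true]
    omega
  rw [if_neg hnew]
  by_cases hsmall : u * τ ≤ outsideCount s light * τ - outsideWeight s x light
  · rw [if_pos hsmall]
    refine ⟨light, (dropSmall s x u light τ).val, L, a,
      (isAVL_searchDelete_and_height_searchDelete_le hs.isAVL_small).1, hL, hab, ?_, rfl⟩
    rw [outsideCount, ← size_dropSmall hs (mul_pos hu.1 hτ) hnew hsmall]
    omega
  · rw [if_neg hsmall]
    obtain ⟨a', hweights, hlength⟩ :=
      exists_weights_dropLarge hL hab hu hτ hsum hsmall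
    refine ⟨light, s.small, (dropLarge s x u light τ L a.length).val, a', hs.isAVL_small,
      (isAVL_searchDelete_and_height_searchDelete_le hL).1, hweights, ?_, ?_⟩
    · rw [outsideCount, ← hlength]
      omega
    · rw [Timed.val_bind, ← hlength, Nat.add_sub_cancel, hlength]

theorem slowStep_represents {k : ℕ} {A : Multiset ℝ} (h : s.Represents k A) (hk : 1 ≤ k)
    (hA : ∀ a ∈ A, 0 < a) (hkA : k ≤ A.card) (hx : 0 < x.weight) (hu : u ∈ Set.Ioo 0 1)
    (hadm : s.Admits x.weight light) :
    (slowStep s x u light).val.Represents k (x.weight ::ₘ A) := by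
  have hL := (isAVL_insertHeavy_and_height_insertHeavy_le (light := light) (x := x)
    h.isAVL_large).1
  have hcand := h.candidates hk hA hx hadm
  have hcard := outsideCount_add_length (light := light) (x := x) h hkA
  obtain ⟨a, b, hab, hval, hend⟩ := Tree.exists_isStop_search (fun c S v =>
    (((outsideCount s light + c : ℕ) : ℝ) - 1) * v ≤ outsideWeight s x light + S) hL 0 0
  simp only [zero_add] at hval
  rw [hab] at hcand hcard
  have hnew := hcand.isNewThreshold (by omega)
    (fun v hv => by simpa only [zero_add] using hend.last v hv) fun v hv => by
      have := hend.first v hv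
      push_cast at this ⊢
      linarith
  rw [slowStep_eq]
  simp only [Timed.val_bind, hval]
  set τ := (outsideWeight s x light + a.sum) / (((outsideCount s light + a.length : ℕ) : ℝ) - 1)
  obtain ⟨light', T', L', a', hT', hL', hab', hsize, hdrop⟩ :=
    exists_dropAndSettle_eq_settle h.toWellFormed hL hab hu hnew.pos hnew.mul_eq
  have hsmall : (settle light' x τ T' L' a'.length).val.small.size + 1 =
      outsideCount s light + a.length := by rw [size_small_settle hT' hL' hab', hsize]
  rw [hdrop]
  refine h.of_split hk hA hkA hx
    (wellFormed_settle hT' hL' hab' (sortedLE_append.1 hcand.sorted).2.1) hab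
    (weights_large_settle hL' hab') hsmall hnew.pos hnew.le hnew.le_of_mem hnew.lt_of_mem ?_
  rw [← hnew.mul_eq, ← hsmall, Nat.cast_add, Nat.cast_one, add_sub_cancel_right]
  rfl

end SlowStep

/-! ### A round -/

section Step

variable {k N : ℕ} {A : Multiset ℝ} {s : State} {x : Item} {u : ℝ}

/-- The processing of `x` while the reservoir is not yet full. -/
noncomputable def fillingStep (s : State) (x : Item) : Timed State := do
  let L ← Tree.insertSorted x s.large
  let m ← Tree.firstWeight L
  pure ⟨L, s.small, s.τ, m⟩

/-- The threshold after the arrival of `x` under the assumption that `x` and the present small items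
are then the candidates up to the threshold. -/
noncomputable def tentativeThreshold (s : State) (x : Item) : ℝ :=
  (x.weight + s.small.size * s.τ) / s.small.size

/-- The condition under which a full reservoir skips `x` in constant time. -/
structure State.SimpleCase (s : State) (x : Item) (u : ℝ) : Prop where
  small_size_ne_zero : s.small.size ≠ 0
  weight_lt : x.weight < tentativeThreshold s x
  lt_minLarge : ∀ v ∈ s.minLarge, tentativeThreshold s x < v
  mul_le : u * tentativeThreshold s x ≤ tentativeThreshold s x - x.weight

theorem State.WellFormed.lt_of_lt_minLarge {τ : ℝ} (hs : s.WellFormed)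
    (hτ : ∀ v ∈ s.minLarge, τ < v) {v : ℝ} (hv : v ∈ s.large.weights) : τ < v := by
  obtain ⟨v', hv', hle⟩ := exists_mem_head?_le hs.sorted hv
  exact (hτ v' (hs.minLarge_eq ▸ hv')).trans_le hle

theorem size_mul_tentativeThreshold (hsize : s.small.size ≠ 0) :
    s.small.size * tentativeThreshold s x = x.weight + s.small.size * s.τ :=
  mul_div_cancel₀ _ (Nat.cast_ne_zero.2 hsize)

theorem step_of_lt (hlt : s.large.size + s.small.size < k) :
    step k s x u = (do tick; fillingStep s x) := by
  simp only [step, fillingStep, if_pos hlt]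

theorem step_of_simpleCase (hfull : k ≤ s.large.size + s.small.size) (hc : s.SimpleCase x u) :
    step k s x u = (do tick; pure { s with τ := tentativeThreshold s x }) := by
  have hfast : ¬ (s.small.size = 0 ∨ tentativeThreshold s x ≤ x.weight ∨
      ∃ v, s.minLarge = some v ∧ v ≤ tentativeThreshold s x) := by
    rintro (h | h | ⟨v, hv, hle⟩)
    · exact hc.small_size_ne_zero h
    · exact h.not_gt hc.weight_lt
    · exact hle.not_gt (hc.lt_minLarge v hv)
  simp only [step, if_neg hfull.not_gt]
  rw [← tentativeThreshold, if_neg hfast, if_pos hc.mul_le]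

theorem State.Represents.exists_step_eq_slowStep (h : s.Represents k A) (hkA : k ≤ A.card)
    (hx : 0 < x.weight) (hc : ¬ s.SimpleCase x u) :
    ∃ light, s.Admits x.weight light ∧ step k s x u = (do tick; slowStep s x u light) := by
  have hfull : ¬ s.large.size + s.small.size < k := by
    rw [h.card_eq, min_eq_left hkA]
    exact lt_irrefl k
  simp only [step, if_neg hfull]
  rw [← tentativeThreshold]
  split_ifs with hslow hskip
  · refine ⟨decide (x.weight ≤ s.τ), ?_, rfl⟩
    rcases le_or_gt x.weight s.τ with hle | hlt
    · rw [decide_eq_true hle]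
      refine ⟨?_, fun v hv => hle.trans (h.τ_lt_of_mem hv).le⟩
      have := mul_le_mul_of_nonneg_left hle (Nat.cast_nonneg (α := ℝ) s.small.size)
      linarith
    · rw [decide_eq_false hlt.not_ge]
      exact hlt
  · push Not at hslow
    exact absurd ⟨hslow.1, hslow.2.1, hslow.2.2, hskip⟩ hc
  · push Not at hslow
    refine ⟨true, ⟨?_, fun v hv => ?_⟩, rfl⟩
    · rw [← size_mul_tentativeThreshold hslow.1]
      exact mul_le_mul_of_nonneg_left hslow.2.1.le (Nat.cast_nonneg _)
    · exact (hslow.2.1.trans (h.lt_of_lt_minLarge hslow.2.2 hv)).le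

theorem fillingStep_represents (h : s.Represents k A) (hA : ∀ a ∈ A, 0 < a) (hkA : A.card < k)
    (hx : 0 < x.weight) : (fillingStep s x).val.Represents k (x.weight ::ₘ A) := by
  have hτ := h.τ_eq_zero hkA.le
  have hxA : ∀ a ∈ x.weight ::ₘ A, 0 < a := Multiset.forall_mem_cons.2 ⟨hx, hA⟩
  have hcard : (x.weight ::ₘ A).card ≤ k := by rwa [Multiset.card_cons]
  have hAVL := (Tree.isAVL_insertSorted_and_height_insertSorted_le (x := x) h.isAVL_large).1
  have hweights := Tree.coe_weights_insertSorted (x := x) h.isAVL_large h.sorted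
  have hsize := congrArg Multiset.card hweights
  rw [Multiset.card_cons, Multiset.coe_card, Multiset.coe_card, ← hAVL.size_eq,
    ← h.isAVL_large.size_eq] at hsize
  have hold := h.card_eq
  refine ⟨⟨hAVL, h.isAVL_small, Tree.sortedLE_weights_insertSorted h.isAVL_large h.sorted,
    Tree.firstWeight_eq_head? _⟩, ?_, ?_, ?_⟩
  · exact hτ.trans (threshold_of_card_le hcard).symm
  · change _ = (x.weight ::ₘ A).filter (s.τ < ·)
    rw [hτ, Multiset.filter_eq_self.2 hxA, ← Multiset.filter_eq_self.2 hA, ← hτ, ← h.large_eq]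
    exact hweights
  · change (Tree.insertSorted x s.large).val.size + s.small.size = _
    rw [hsize, Multiset.card_cons]
    omega

theorem State.SimpleCase.represents (hc : s.SimpleCase x u) (h : s.Represents k A) (hk : 1 ≤ k)
    (hA : ∀ a ∈ A, 0 < a) (hkA : k ≤ A.card) (hx : 0 < x.weight) :
    State.Represents { s with τ := tentativeThreshold s x } k (x.weight ::ₘ A) := by
  have hmul := size_mul_tentativeThreshold (x := x) hc.small_size_ne_zero
  have hle : s.τ ≤ tentativeThreshold s x := by
    refine le_of_mul_le_mul_left ?_ (Nat.cast_pos.2 (Nat.pos_of_ne_zero hc.small_size_ne_zero))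
    rw [hmul]
    exact le_add_of_nonneg_left hx.le
  refine State.Represents.of_total_eq ⟨h.isAVL_large, h.isAVL_small, h.sorted, h.minLarge_eq⟩
    (Multiset.forall_mem_cons.2 ⟨hx, hA⟩) (by rw [Multiset.card_cons]; omega)
    (hx.trans hc.weight_lt) ?_ (h.card_eq.trans (min_eq_left hkA)) ?_
  · change (s.large.weights : Multiset ℝ) = _
    rw [Multiset.filter_cons_of_neg _ (not_lt.2 hc.weight_lt.le), ← filter_lt_filter_lt hle,
      ← h.large_eq, eq_comm, Multiset.filter_eq_self]
    exact fun v hv => h.lt_of_lt_minLarge hc.lt_minLarge hv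
  · change s.small.size * tentativeThreshold s x + s.large.weights.sum = _
    rw [hmul, add_assoc, h.total_eq hk hA, Multiset.sum_cons]

theorem step_represents (h : s.Represents k A) (hk : 1 ≤ k) (hA : ∀ a ∈ A, 0 < a)
    (hx : 0 < x.weight) (hu : u ∈ Set.Ioo 0 1) :
    (step k s x u).val.Represents k (x.weight ::ₘ A) := by
  have hcard := h.card_eq
  rcases lt_or_ge A.card k with hlt | hge
  · rw [step_of_lt (by omega)]
    exact fillingStep_represents h hA hlt hx
  by_cases hc : s.SimpleCase x u
  · rw [step_of_simpleCase (by omega) hc]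
    exact hc.represents h hk hA hge hx
  · obtain ⟨light, hadm, hstep⟩ := h.exists_step_eq_slowStep hge hx hc
    rw [hstep]
    exact slowStep_represents h hk hA hge hx hu hadm

/-- A bound on the number of steps, besides the first one, of processing an item with a reservoir of
at most `N` items. -/
def slowCost (N : ℕ) : ℕ := 43 * Tree.maxHeight N + 77

theorem steps_fillingStep_le (hs : s.WellFormed) (hN : s.large.size ≤ N) :
    (fillingStep s x).steps ≤ slowCost N := by
  have hheight := hs.isAVL_large.height_le_maxHeight hN
  obtain ⟨hAVL, hinsert⟩ :=
    Tree.isAVL_insertSorted_and_height_insertSorted_le (x := x) hs.isAVL_large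
  have hinsert_steps := Tree.steps_insertSorted_le (x := x) hs.isAVL_large
  have hfirst_steps := Tree.steps_firstWeight_le hAVL
  simp only [fillingStep, Timed.steps_bind, Timed.steps_pure, slowCost]
  omega

theorem steps_step_le (h : s.Represents k A) (hx : 0 < x.weight)
    (hN : min k A.card ≤ N) : (step k s x u).steps ≤ 1 + slowCost N := by
  have hcard := h.card_eq
  rcases lt_or_ge A.card k with hlt | hge
  · rw [step_of_lt (by omega)]
    exact Nat.add_le_add_left (steps_fillingStep_le h.toWellFormed (by omega)) 1
  by_cases hc : s.SimpleCase x u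
  · rw [step_of_simpleCase (by omega) hc]
    exact Nat.le_add_right 1 _
  · obtain ⟨light, -, hstep⟩ := h.exists_step_eq_slowStep hge hx hc
    rw [hstep]
    exact Nat.add_le_add_left (steps_slowStep_le h.toWellFormed
      (h.isAVL_small.height_le_maxHeight (by omega))
      (h.isAVL_large.height_le_maxHeight (by omega))) 1

end Step

section Amortization

variable {k N : ℕ} {A : Multiset ℝ} {s s' : State} {x : Item} {u w : ℝ}

theorem State.Represents.τ_le (h : s.Represents k A) (h' : s'.Represents k (w ::ₘ A)) (hk : 1 ≤ k)
    (hA : ∀ a ∈ A, 0 < a) (hw : 0 < w) : s.τ ≤ s'.τ := by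
  rw [h.τ_eq, h'.τ_eq]
  exact threshold_le_threshold_cons hk hA hw

theorem State.Represents.large_size_le_add_one (h : s.Represents k A)
    (h' : s'.Represents k (w ::ₘ A)) (hτ : s.τ ≤ s'.τ) : s'.large.size ≤ s.large.size + 1 := by
  have hfilter := Multiset.monotone_filter_right A fun v (hv : s'.τ < v) => hτ.trans_lt hv
  rw [h.large_size_eq, h'.large_size_eq]
  calc ((w ::ₘ A).filter (s'.τ < ·)).card ≤ (w ::ₘ A.filter (s'.τ < ·)).card := by
        refine Multiset.card_le_card ?_
        rw [← Multiset.singleton_add, ← Multiset.singleton_add, Multiset.filter_add]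
        exact Multiset.add_le_add_right (Multiset.filter_le _ _)
    _ = (A.filter (s'.τ < ·)).card + 1 := Multiset.card_cons _ _
    _ ≤ (A.filter (s.τ < ·)).card + 1 := Nat.add_le_add_right (Multiset.card_le_card hfilter) 1

theorem State.Represents.size_mul_τ_eq (h : s.Represents k A) (h' : s'.Represents k (w ::ₘ A))
    (hk : 1 ≤ k) (hA : ∀ a ∈ A, 0 < a) (hkA : k ≤ A.card) (hw : 0 < w)
    (hlarge : (s'.large.weights : Multiset ℝ) = s.large.weights) :
    s.small.size * s'.τ = w + s.small.size * s.τ := by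
  have hsum := congrArg Multiset.sum hlarge
  have hcard := congrArg Multiset.card hlarge
  simp only [Multiset.sum_coe, Multiset.coe_card, ← h.isAVL_large.size_eq,
    ← h'.isAVL_large.size_eq] at hsum hcard
  have hsize : s'.small.size = s.small.size := by
    have := h.card_eq
    have := h'.card_eq
    rw [Multiset.card_cons] at this
    omega
  have htotal := h.total_eq hk hA
  have htotal' := h'.total_eq hk (Multiset.forall_mem_cons.2 ⟨hw, hA⟩)
  rw [hsize, hsum, Multiset.sum_cons] at htotal'
  linarith

theorem simpleCase_of_size_mul_eq {τ : ℝ} (hτ : 0 < τ) (hx : 0 < x.weight) (hs : 0 ≤ s.τ)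
    (hsize : s.small.size * τ = x.weight + s.small.size * s.τ) (hmin : ∀ v ∈ s.minLarge, τ < v)
    (hu : 0 < u) (hmul : u * τ ≤ τ - x.weight) : s.SimpleCase x u := by
  have hpos : 0 < s.small.size * τ :=
    hsize ▸ add_pos_of_pos_of_nonneg hx (mul_nonneg (Nat.cast_nonneg _) hs)
  have hne : (s.small.size : ℝ) ≠ 0 := left_ne_zero_of_mul hpos.ne'
  have htentative : tentativeThreshold s x = τ := by
    rw [tentativeThreshold, ← hsize, mul_div_cancel_left₀ _ hne]
  refine ⟨Nat.cast_ne_zero.1 hne, ?_, htentative ▸ hmin, htentative ▸ hmul⟩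
  rw [htentative, ← sub_pos]
  exact (mul_pos hu hτ).trans_le hmul

theorem State.Represents.large_size_lt (h : s.Represents k A)
    (h' : s'.Represents k (x.weight ::ₘ A)) (hk : 1 ≤ k) (hA : ∀ a ∈ A, 0 < a)
    (hkA : k ≤ A.card) (hx : 0 < x.weight) (hu : 0 < u)
    (hinc : ¬ Included k (x.weight ::ₘ A) x.weight u) (hc : ¬ s.SimpleCase x u) :
    s'.large.size < s.large.size := by
  have hτ := h.τ_le h' hk hA hx
  have hτ_nonneg := h.τ_nonneg hk hA
  rw [Included, ← h'.τ_eq, not_lt] at hinc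
  have hweight : x.weight ≤ s'.τ :=
    sub_nonneg.1 ((mul_nonneg hu.le (hτ_nonneg.trans hτ)).trans hinc)
  have hlarge := h'.large_eq
  rw [Multiset.filter_cons_of_neg _ (not_lt.2 hweight), ← filter_lt_filter_lt hτ,
    ← h.large_eq] at hlarge
  rw [h.isAVL_large.size_eq, h'.isAVL_large.size_eq, ← Multiset.coe_card, ← Multiset.coe_card,
    hlarge]
  refine (Multiset.card_le_card (Multiset.filter_le _ _)).lt_of_ne fun hcard => hc ?_
  have hfilter := Multiset.eq_of_le_of_card_le (Multiset.filter_le _ _) hcard.ge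
  refine simpleCase_of_size_mul_eq (hx.trans_le hweight) hx hτ_nonneg
    (h.size_mul_τ_eq h' hk hA hkA hx (hlarge.trans hfilter)) (fun v hv => ?_) hu hinc
  exact Multiset.filter_eq_self.1 hfilter v
    (Multiset.mem_coe.2 (List.mem_of_head? (h.minLarge_eq ▸ hv)))

open Classical in
theorem steps_step_add_mul_large_size_le (h : s.Represents k A) (hk : 1 ≤ k)
    (hA : ∀ a ∈ A, 0 < a) (hx : 0 < x.weight) (hu : u ∈ Set.Ioo 0 1) (hN : min k A.card ≤ N) :
    (step k s x u).steps + slowCost N * (step k s x u).val.large.size ≤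
      1 + slowCost N * s.large.size +
        2 * slowCost N * (if Included k (x.weight ::ₘ A) x.weight u then 1 else 0) := by
  have hsteps := steps_step_le (u := u) h hx hN
  have h' := step_represents h hk hA hx hu
  split_ifs with hinc
  · have := Nat.mul_le_mul_left (slowCost N) (h.large_size_le_add_one h' (h.τ_le h' hk hA hx))
    rw [mul_add] at this
    omega
  have hkA : k ≤ A.card := by
    by_contra! hlt
    refine hinc ?_
    rw [Included, threshold_of_card_le (by rwa [Multiset.card_cons]), mul_zero, zero_sub]
    exact neg_neg_of_pos hx
  by_cases hc : s.SimpleCase x u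
  · rw [step_of_simpleCase (h.card_eq.trans (min_eq_left hkA)).ge hc]
    exact le_rfl
  · have := Nat.mul_le_mul_left (slowCost N) (h.large_size_lt h' hk hA hkA hx hu.1 hinc hc)
    rw [Nat.mul_succ] at this
    omega

end Amortization

/-! ### Runs of the algorithm -/

section Run

variable {k n N : ℕ}

/-- The multiset of the values of a finite sequence up to and including index `i`. -/
def prefixMultiset {α : Type*} {n : ℕ} (f : Fin n → α) (i : Fin n) : Multiset α :=
  (Finset.Iic i).val.map f

theorem prefixMultiset_zero {α : Type*} (f : Fin (n + 1) → α) : prefixMultiset f 0 = {f 0} := by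
  have hIic : Finset.Iic (0 : Fin (n + 1)) = {0} := Finset.Iic_bot
  rw [prefixMultiset, hIic, Finset.singleton_val, Multiset.map_singleton]

theorem prefixMultiset_succ {α : Type*} (f : Fin (n + 1) → α) (i : Fin n) :
    prefixMultiset f i.succ = f 0 ::ₘ prefixMultiset (fun j => f j.succ) i := by
  have hIic : Finset.Iic i.succ = Finset.cons 0 ((Finset.Iic i).map (Fin.succEmb n)) (by simp) := by
    ext j
    refine Fin.cases ?_ (fun j => ?_) j <;> simp
  rw [prefixMultiset, hIic, Finset.cons_val, Finset.map_val, Multiset.map_cons, Multiset.map_map]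
  rfl

theorem card_prefixMultiset {α : Type*} (f : Fin n → α) (i : Fin n) :
    (prefixMultiset f i).card = i + 1 := by
  rw [prefixMultiset, Multiset.card_map, Finset.card_val, Fin.card_Iic]

open Classical in
theorem steps_run_le (hk : 1 ≤ k) {x : Fin n → Item} {u : Fin n → ℝ}
    (hx : ∀ i, 0 < (x i).weight) (hu : ∀ i, u i ∈ Set.Ioo 0 1) {A : Multiset ℝ} {s : State}
    (h : s.Represents k A) (hA : ∀ a ∈ A, 0 < a) (hN : min k (A.card + n) ≤ N) :
    (run k s (List.ofFn fun i => (x i, u i))).steps ≤ n + slowCost N * s.large.size +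
      2 * slowCost N * ∑ i, if Included k (prefixMultiset (fun j => (x j).weight) i + A)
        (x i).weight (u i) then 1 else 0 := by
  induction n generalizing A s with
  | zero => exact Nat.zero_le _
  | succ n ih =>
    have hstep := steps_step_add_mul_large_size_le h hk hA (hx 0) (hu 0) (N := N) (by omega)
    have hrun := ih (fun i => hx i.succ) (fun i => hu i.succ)
      (step_represents h hk hA (hx 0) (hu 0)) (Multiset.forall_mem_cons.2 ⟨hx 0, hA⟩)
      (by rw [Multiset.card_cons]; omega)
    simp only [Multiset.add_cons] at hrun
    simp only [List.ofFn_succ, run, Timed.steps_bind, Fin.sum_univ_succ, mul_add,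
      prefixMultiset_zero, prefixMultiset_succ, Multiset.singleton_add, Multiset.cons_add]
    omega

open Classical in
theorem time_le (hk : 1 ≤ k) {w : Fin n → ℝ} (hw : ∀ i, 0 < w i) (σ : Equiv.Perm (Fin n))
    {u : Fin n → ℝ} (hu : ∀ i, u i ∈ Set.Ioo 0 1) :
    time k w σ u ≤ n + 2 * slowCost (min k n) *
      ∑ i, if Included k (prefixMultiset (w ∘ σ) i) (w (σ i)) (u i) then 1 else 0 := by
  have hrun := steps_run_le hk (x := fun i => ⟨(σ i : ℕ), w (σ i)⟩) (fun i => hw (σ i)) hu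
    (State.Represents.init k) (fun a ha => absurd ha (Multiset.notMem_zero a))
    (N := min k n) (by rw [Multiset.card_zero, zero_add])
  simp only [add_zero, show State.init.large.size = 0 from rfl, mul_zero] at hrun
  exact hrun

end Run

/-! ### Expectation over the random numbers -/

open MeasureTheory

/-- The function `f` is (the underlying function of) a simple function, that is, it has finitely
many values and measurable fibres. The algorithm depends in this way on its random numbers, since it
uses them in comparisons only. No structure is required on the codomain. -/
def IsSimple {Ω β : Type*} [MeasurableSpace Ω] (f : Ω → β) : Prop :=
  ∃ g : SimpleFunc Ω β, ⇑g = f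

namespace IsSimple

variable {Ω Ω' β γ : Type*} [MeasurableSpace Ω] [MeasurableSpace Ω'] {f g : Ω → β}

theorem const (b : β) : IsSimple fun _ : Ω => b :=
  ⟨SimpleFunc.const Ω b, rfl⟩

theorem dependent_comp {F : β → Ω → γ} (hf : IsSimple f) (hF : ∀ b, IsSimple (F b)) :
    IsSimple fun ω => F (f ω) ω := by
  obtain ⟨f', rfl⟩ := hf
  choose F' hF' using hF
  exact ⟨f'.bind F', funext fun ω => congrFun (hF' (f' ω)) ω⟩

theorem map (φ : β → γ) (hf : IsSimple f) : IsSimple fun ω => φ (f ω) :=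
  hf.dependent_comp fun b => const (φ b)

theorem comp_measurable (hf : IsSimple f) {φ : Ω' → Ω} (hφ : Measurable φ) :
    IsSimple fun ω => f (φ ω) := by
  obtain ⟨f', rfl⟩ := hf
  exact ⟨f'.comp φ hφ, rfl⟩

theorem ite {p : Ω → Prop} [DecidablePred p] (hp : MeasurableSet {ω | p ω}) (hf : IsSimple f)
    (hg : IsSimple g) : IsSimple fun ω => if p ω then f ω else g ω := by
  classical
  obtain ⟨f', rfl⟩ := hf
  obtain ⟨g', rfl⟩ := hg
  refine ⟨SimpleFunc.piecewise _ hp f' g', funext fun ω => ?_⟩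
  simp only [SimpleFunc.coe_piecewise, Set.piecewise, Set.mem_ofPred_eq]
  split_ifs <;> rfl

theorem bind {β γ : Type} {x : Ω → Timed β} {y : β → Ω → Timed γ} (hx : IsSimple x)
    (hy : ∀ b, IsSimple (y b)) : IsSimple fun ω => x ω >>= fun b => y b ω :=
  hx.dependent_comp (F := fun t ω => t >>= fun b => y b ω) fun t =>
    (hy t.val).map fun z => (⟨z.val, t.steps + z.steps⟩ : Timed γ)

theorem integrable {f : Ω → ℕ} (hf : IsSimple f) (μ : Measure Ω) [IsFiniteMeasure μ] :
    Integrable (fun ω => (f ω : ℝ)) μ := by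
  obtain ⟨f', hf'⟩ := hf.map (Nat.cast (R := ℝ))
  exact hf' ▸ f'.integrable_of_isFiniteMeasure

end IsSimple

section Simplicity

variable {Ω : Type*} [MeasurableSpace Ω]

theorem isSimple_search {goRight : Ω → ℕ → ℝ → ℝ → Prop} [∀ ω c s v, Decidable (goRight ω c s v)]
    (h : ∀ c s v, MeasurableSet {ω | goRight ω c s v}) (t : Tree) (c : ℕ) (s : ℝ) :
    IsSimple fun ω => Tree.search (goRight ω) t c s := by
  induction t generalizing c s with
  | leaf => exact IsSimple.const _
  | node _ _ _ l x r ihl ihr =>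
    simp only [Tree.search]
    exact (IsSimple.const _).bind fun _ => (ihr _ _).ite (h _ _ _) (ihl _ _)

theorem isSimple_searchDelete {goRight : Ω → ℕ → ℝ → ℝ → Prop}
    [∀ ω c s v, Decidable (goRight ω c s v)]
    (h : ∀ c s v, MeasurableSet {ω | goRight ω c s v}) (t : Tree) :
    IsSimple fun ω => searchDelete (goRight ω) t :=
  (isSimple_search h t 0 0).bind fun _ => IsSimple.const _

theorem isSimple_dropSmall (s : State) (x : Item) (light : Bool) (τ : ℝ) :
    IsSimple fun u => dropSmall s x u light τ :=
  isSimple_searchDelete (fun _ _ _ => measurableSet_lt measurable_const (measurable_mul_const τ)) _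

theorem isSimple_dropLarge (s : State) (x : Item) (light : Bool) (τ : ℝ) (L : Tree) (m : ℕ) :
    IsSimple fun u => dropLarge s x u light τ L m := by
  refine isSimple_searchDelete (fun c S _ => ?_) L
  exact (MeasurableSet.const _).inter (measurableSet_lt measurable_const (measurable_mul_const τ))

theorem isSimple_dropAndSettle (s : State) (x : Item) (light : Bool) (τ : ℝ) (L : Tree) (m : ℕ) :
    IsSimple fun u => dropAndSettle s x u light τ L m := by
  have hle (a : ℝ) : MeasurableSet {u : ℝ | u * τ ≤ a} :=
    measurableSet_le (measurable_mul_const τ) measurable_const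
  refine IsSimple.ite ((MeasurableSet.const _).inter (hle _)) (IsSimple.const _)
    (IsSimple.ite (hle _) ?_ ?_)
  · exact (isSimple_dropSmall s x light τ).bind fun _ => IsSimple.const _
  · exact (isSimple_dropLarge s x light τ L m).bind fun _ => IsSimple.const _

theorem isSimple_slowStep (s : State) (x : Item) (light : Bool) :
    IsSimple fun u => slowStep s x u light := by
  simp only [slowStep_eq]
  exact (IsSimple.const _).bind fun _ => (IsSimple.const _).bind fun _ =>
    (IsSimple.const _).bind fun _ => isSimple_dropAndSettle s x light _ _ _

theorem isSimple_step (k : ℕ) (s : State) (x : Item) : IsSimple fun u => step k s x u := by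
  refine (IsSimple.const _).bind fun _ => IsSimple.ite (MeasurableSet.const _) (IsSimple.const _)
    (IsSimple.ite (MeasurableSet.const _) (isSimple_slowStep _ _ _) ?_)
  exact IsSimple.ite (measurableSet_le (measurable_id.mul_const _) measurable_const)
    (IsSimple.const _) (isSimple_slowStep _ _ _)

theorem isSimple_run (k : ℕ) {n : ℕ} (x : Fin n → Item) {u : Fin n → Ω → ℝ}
    (hu : ∀ i, Measurable (u i)) (s : State) :
    IsSimple fun ω => run k s (List.ofFn fun i => (x i, u i ω)) := by
  induction n generalizing s with
  | zero => exact IsSimple.const _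
  | succ n ih =>
    simp only [List.ofFn_succ, run]
    exact ((isSimple_step k s (x 0)).comp_measurable (hu 0)).bind fun s' =>
      ih (fun i => x i.succ) (fun i => hu i.succ) s'

theorem isSimple_time (k : ℕ) {n : ℕ} (w : Fin n → ℝ) (σ : Equiv.Perm (Fin n)) :
    IsSimple fun u => time k w σ u :=
  (isSimple_run k _ measurable_pi_apply State.init).map Timed.steps

end Simplicity

section Expectation

variable {k n : ℕ}

instance isProbabilityMeasure_uniformNumbers (n : ℕ) : IsProbabilityMeasure (uniformNumbers n) := by
  unfold uniformNumbers
  infer_instance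

theorem integrable_time (k : ℕ) (w : Fin n → ℝ) (σ : Equiv.Perm (Fin n)) :
    Integrable (fun u => (time k w σ u : ℝ)) (uniformNumbers n) :=
  (isSimple_time k w σ).integrable _

theorem measurePreserving_eval_uniformNumbers (i : Fin n) :
    MeasurePreserving (fun u : Fin n → ℝ => u i) (uniformNumbers n)
      (volume.restrict (Set.Ioo (0 : ℝ) 1)) :=
  measurePreserving_eval _ i

theorem ae_mem_Ioo_uniformNumbers (n : ℕ) :
    ∀ᵐ u ∂uniformNumbers n, ∀ i, u i ∈ Set.Ioo (0 : ℝ) 1 :=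
  ae_all_iff.2 fun i => (measurePreserving_eval_uniformNumbers i).quasiMeasurePreserving.ae
    (ae_restrict_mem measurableSet_Ioo)

open Classical in
theorem isSimple_included (k : ℕ) (B : Multiset ℝ) (w : ℝ) (i : Fin n) :
    IsSimple fun u : Fin n → ℝ => if Included k B w (u i) then 1 else 0 :=
  ((IsSimple.const 1).ite measurableSet_included (IsSimple.const 0)).comp_measurable
    (measurable_pi_apply i)

open Classical in
theorem integral_included (k : ℕ) (B : Multiset ℝ) (w : ℝ) (i : Fin n) :
    ∫ u, ((if Included k B w (u i) then 1 else 0 : ℕ) : ℝ) ∂uniformNumbers n = inclProb k B w := by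
  have hpreimage : MeasurableSet ((fun u : Fin n → ℝ => u i) ⁻¹' {u | Included k B w u}) :=
    measurableSet_included.preimage (measurable_pi_apply i)
  rw [inclProb, ← (measurePreserving_eval_uniformNumbers i).measureReal_preimage
    measurableSet_included.nullMeasurableSet, ← integral_indicator_one hpreimage]
  refine integral_congr_ae (.of_forall fun u => ?_)
  simp [Set.indicator]

theorem integral_time_le (hk : 1 ≤ k) {w : Fin n → ℝ} (hw : ∀ i, 0 < w i)
    (σ : Equiv.Perm (Fin n)) :
    ∫ u, (time k w σ u : ℝ) ∂uniformNumbers n ≤ n + 2 * slowCost (min k n) *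
      ∑ i, inclProb k (prefixMultiset (w ∘ σ) i) (w (σ i)) := by
  classical
  have hintegrable (i : Fin n) :=
    (isSimple_included k (prefixMultiset (w ∘ σ) i) (w (σ i)) i).integrable (uniformNumbers n)
  have hsum := (integrable_finsetSum Finset.univ fun i _ => hintegrable i).const_mul
    (2 * slowCost (min k n) : ℝ)
  calc ∫ u, (time k w σ u : ℝ) ∂uniformNumbers n
      ≤ ∫ u, ((n : ℝ) + 2 * slowCost (min k n) * ∑ i, ((if Included k
          (prefixMultiset (w ∘ σ) i) (w (σ i)) (u i) then 1 else 0 : ℕ) : ℝ))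
          ∂uniformNumbers n := by
        refine integral_mono_ae (integrable_time k w σ) ((integrable_const _).add hsum) ?_
        filter_upwards [ae_mem_Ioo_uniformNumbers n] with u hu
        exact_mod_cast time_le hk hw σ hu
    _ = _ := by
        rw [integral_add (integrable_const _) hsum, integral_const_mul,
          integral_finsetSum _ fun i _ => hintegrable i, integral_const, probReal_univ, one_smul]
        simp only [integral_included]

end Expectation

/-! ### Expectation over the order -/

section RandomOrder

variable {k n : ℕ}

theorem map_swap_Iic {m i : Fin n} (hmi : m ≤ i) :
    (Finset.Iic i).map (Equiv.swap m i).toEmbedding = Finset.Iic i := by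
  refine Finset.eq_of_subset_of_card_le (fun j hj => ?_) (Finset.card_map _).ge
  obtain ⟨l, hl, rfl⟩ := Finset.mem_map.1 hj
  rw [Finset.mem_Iic] at hl ⊢
  rw [Equiv.coe_toEmbedding, Equiv.swap_apply_def]
  split_ifs
  exacts [le_rfl, hmi, hl]

theorem prefixMultiset_comp_swap {α : Type*} (f : Fin n → α) {m i : Fin n} (hmi : m ≤ i) :
    prefixMultiset (f ∘ Equiv.swap m i) i = prefixMultiset f i := by
  rw [prefixMultiset, prefixMultiset, ← Multiset.map_map, ← Equiv.coe_toEmbedding,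
    ← Finset.map_val, map_swap_Iic hmi]

/-- In a random order, each of the items seen so far is equally likely to be the last one. -/
theorem succ_mul_sum_perm_prefixMultiset {α : Type*} (F : Multiset α → α → ℝ) (f : Fin n → α)
    (i : Fin n) :
    ((i : ℝ) + 1) * ∑ σ : Equiv.Perm (Fin n), F (prefixMultiset (f ∘ σ) i) (f (σ i)) =
      ∑ σ : Equiv.Perm (Fin n),
        ((prefixMultiset (f ∘ σ) i).map (F (prefixMultiset (f ∘ σ) i))).sum := by
  have hswap (m : Fin n) (hm : m ∈ Finset.Iic i) :
      ∑ σ : Equiv.Perm (Fin n), F (prefixMultiset (f ∘ σ) i) (f (σ m)) =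
        ∑ σ : Equiv.Perm (Fin n), F (prefixMultiset (f ∘ σ) i) (f (σ i)) := by
    refine (Fintype.sum_equiv (Equiv.mulRight (Equiv.swap m i)) _ _ fun σ => ?_).symm
    rw [Equiv.coe_mulRight, Equiv.Perm.coe_mul, ← Function.comp_assoc,
      prefixMultiset_comp_swap _ (Finset.mem_Iic.1 hm), Function.comp_apply,
      Equiv.swap_apply_left]
  calc ((i : ℝ) + 1) * ∑ σ : Equiv.Perm (Fin n), F (prefixMultiset (f ∘ σ) i) (f (σ i))
      = ∑ m ∈ Finset.Iic i, ∑ σ : Equiv.Perm (Fin n),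
          F (prefixMultiset (f ∘ σ) i) (f (σ m)) := by
        rw [Finset.sum_congr rfl hswap, Finset.sum_const, Fin.card_Iic, nsmul_eq_mul,
          Nat.cast_succ]
    _ = _ := by
        rw [Finset.sum_comm]
        refine Finset.sum_congr rfl fun σ _ => ?_
        conv_rhs => rw [prefixMultiset, Multiset.map_map]
        rfl

theorem sum_perm_inclProb_le (hk : 1 ≤ k) {w : Fin n → ℝ} (hw : ∀ i, 0 < w i) (i : Fin n) :
    ∑ σ : Equiv.Perm (Fin n), inclProb k (prefixMultiset (w ∘ σ) i) (w (σ i)) ≤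
      n.factorial * (min (k : ℝ) (i + 1) / (i + 1)) := by
  rw [← mul_div_assoc, le_div_iff₀' (by positivity), succ_mul_sum_perm_prefixMultiset (inclProb k)]
  have hbound (σ : Equiv.Perm (Fin n)) : ((prefixMultiset (w ∘ σ) i).map
      (inclProb k (prefixMultiset (w ∘ σ) i))).sum ≤ min (k : ℝ) (i + 1) := by
    have hpos : ∀ a ∈ prefixMultiset (w ∘ σ) i, 0 < a :=
      Multiset.forall_mem_map_iff.2 fun j _ => hw (σ j)
    refine (sum_inclProb_le hk hpos).trans_eq ?_
    rw [card_prefixMultiset, Nat.cast_succ]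
  refine (Finset.sum_le_card_nsmul _ _ _ fun σ _ => hbound σ).trans_eq ?_
  rw [Finset.card_univ, Fintype.card_perm, Fintype.card_fin, nsmul_eq_mul]

theorem expectedTime_le (hk : 1 ≤ k) {w : Fin n → ℝ} (hw : ∀ i, 0 < w i) :
    expectedTime k w ≤ n + 2 * slowCost (min k n) * ∑ i : Fin n, min (k : ℝ) (i + 1) / (i + 1) := by
  have hfactorial : (0 : ℝ) < n.factorial := Nat.cast_pos.2 n.factorial_pos
  rw [expectedTime, div_le_iff₀' hfactorial]
  calc ∑ σ : Equiv.Perm (Fin n), ∫ u, (time k w σ u : ℝ) ∂uniformNumbers n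
      ≤ ∑ σ : Equiv.Perm (Fin n), (n + 2 * slowCost (min k n) *
          ∑ i, inclProb k (prefixMultiset (w ∘ σ) i) (w (σ i))) :=
        Finset.sum_le_sum fun σ _ => integral_time_le hk hw σ
    _ = n.factorial * n + 2 * slowCost (min k n) *
          ∑ i, ∑ σ : Equiv.Perm (Fin n), inclProb k (prefixMultiset (w ∘ σ) i) (w (σ i)) := by
        rw [Finset.sum_add_distrib, Finset.sum_const, Finset.card_univ, Fintype.card_perm,
          Fintype.card_fin, nsmul_eq_mul, ← Finset.mul_sum, Finset.sum_comm]
    _ ≤ n.factorial * n + 2 * slowCost (min k n) *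
          ∑ i : Fin n, n.factorial * (min (k : ℝ) (i + 1) / (i + 1)) := by
        gcongr with i
        exact sum_perm_inclProb_le hk hw i
    _ = _ := by
        rw [← Finset.mul_sum]
        ring

end RandomOrder

section Estimates

theorem sum_min_div_le_natCast (k n : ℕ) :
    ∑ i : Fin n, min (k : ℝ) (i + 1) / (i + 1) ≤ n := by
  refine (Finset.sum_le_card_nsmul _ _ 1 fun i _ => ?_).trans_eq ?_
  · exact (div_le_one (by positivity)).2 (min_le_right _ _)
  · rw [Finset.card_univ, Fintype.card_fin, nsmul_eq_mul, mul_one]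

theorem sum_min_div_le_mul_log (k n : ℕ) :
    ∑ i : Fin n, min (k : ℝ) (i + 1) / (i + 1) ≤ k * (1 + Real.log n) := by
  calc ∑ i : Fin n, min (k : ℝ) (i + 1) / (i + 1)
      ≤ ∑ i : Fin n, k * ((i : ℝ) + 1)⁻¹ := by
        gcongr with i
        rw [div_eq_mul_inv]
        gcongr
        exact min_le_left _ _
    _ = k * (harmonic n : ℝ) := by
        rw [← Finset.mul_sum, harmonic, Fin.sum_univ_eq_sum_range (fun i => ((i : ℝ) + 1)⁻¹)]
        push_cast
        rfl
    _ ≤ k * (1 + Real.log n) := by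
        gcongr
        exact harmonic_le_one_add_log n

theorem log_min_mul_sum_min_div_le (k n : ℕ) :
    Real.log (min k n : ℕ) * ∑ i : Fin n, min (k : ℝ) (i + 1) / (i + 1) ≤
      3 * (k * Real.log k * Real.log n) := by
  have hlogk := Real.log_natCast_nonneg k
  rcases Nat.lt_or_ge 1 (min k n) with hmin | hmin
  · have hlog_min : Real.log (min k n : ℕ) ≤ Real.log k :=
      Real.log_le_log (by positivity) (Nat.cast_le.2 (min_le_left k n))
    have hlog_two : Real.log 2 ≤ Real.log n :=
      Real.log_le_log two_pos (by exact_mod_cast hmin.trans_le (min_le_right k n))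
    calc Real.log (min k n : ℕ) * ∑ i : Fin n, min (k : ℝ) (i + 1) / (i + 1)
        ≤ Real.log k * (k * (1 + Real.log n)) :=
          mul_le_mul hlog_min (sum_min_div_le_mul_log k n) (by positivity) hlogk
      _ ≤ Real.log k * (k * (3 * Real.log n)) := by
          gcongr
          linarith [Real.log_two_gt_d9]
      _ = 3 * (k * Real.log k * Real.log n) := by ring
  · have hlog_min : Real.log (min k n : ℕ) = 0 :=
      le_antisymm (Real.log_nonpos (Nat.cast_nonneg _) (Nat.cast_le_one.2 hmin))
        (Real.log_natCast_nonneg _)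
    rw [hlog_min, zero_mul]
    positivity

theorem natLog_two_le_two_mul_log (N : ℕ) : (Nat.log 2 N : ℝ) ≤ 2 * Real.log N := by
  refine (Real.natLog_le_logb N 2).trans ?_
  rw [Real.logb, div_le_iff₀ (Real.log_pos (by norm_num))]
  push_cast
  nlinarith [Real.log_two_gt_d9, Real.log_natCast_nonneg N]

theorem slowCost_le (N : ℕ) : (slowCost N : ℝ) ≤ 206 + 172 * Real.log N := by
  have hsucc : Nat.log 2 (N + 1) ≤ Nat.log 2 N + 1 := by
    rcases N.eq_zero_or_pos with rfl | hN
    · exact (Nat.log_one_right 2).trans_le (Nat.zero_le _)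
    · exact (Nat.log_mono_right (by omega)).trans_eq (Nat.log_mul_base one_lt_two hN.ne')
  have hcost : slowCost N ≤ 206 + 86 * Nat.log 2 N := by
    rw [slowCost, Tree.maxHeight]
    omega
  have hcast : (slowCost N : ℝ) ≤ 206 + 86 * Nat.log 2 N := by exact_mod_cast hcost
  linarith [natLog_two_le_two_mul_log N]

end Estimates

end VarOpt

theorem mainTheorem8 :
    ∃ C : ℝ, ∀ (k n : ℕ) (w : Fin n → ℝ), 1 ≤ k → (∀ i, 0 < w i) →
      (∀ σ : Equiv.Perm (Fin n), MeasureTheory.Integrable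
        (fun u : Fin n → ℝ => (VarOpt.time k w σ u : ℝ)) (VarOpt.uniformNumbers n)) ∧
      VarOpt.expectedTime k w ≤ C * ((n : ℝ) + (k : ℝ) * Real.log k * Real.log n) := by
  refine ⟨1032, fun k n w hk hw => ⟨VarOpt.integrable_time k w, ?_⟩⟩
  set M := ∑ i : Fin n, min (k : ℝ) (i + 1) / (i + 1) with hM
  have hM_nonneg : 0 ≤ M := Finset.sum_nonneg fun i _ => by positivity
  have hM_le : M ≤ n := VarOpt.sum_min_div_le_natCast k n
  have hlog : Real.log (min k n : ℕ) * M ≤ 3 * (k * Real.log k * Real.log n) :=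
    VarOpt.log_min_mul_sum_min_div_le k n
  calc VarOpt.expectedTime k w
      ≤ n + 2 * VarOpt.slowCost (min k n) * M := VarOpt.expectedTime_le hk hw
    _ ≤ n + 2 * (206 + 172 * Real.log (min k n : ℕ)) * M := by
        gcongr
        exact VarOpt.slowCost_le _
    _ ≤ 1032 * (n + k * Real.log k * Real.log n) := by linarith [n.cast_nonneg (α := ℝ)]
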